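/- Let $P$ be a poset, regarded as a category with a unique morphism $x\to y$ whenever $x\le y$ (so that the product $a\times b$ and the coproduct $a\cup b$ in $P$, when they exist, are the meet and the join of $a$ and $b$). Suppose that (i) $P$ contains an element $c$ such that $c\times x$ and $c\cup x$ exist in $P$ for every $x\in P$; (ii) any two elements $a,b\in P$ that have a common lower bound in $P$ have a meet $a\times b$ in $P$, and any two elements $a,b\in P$ that have a common upper bound in $P$ have a join $a\cup b$ in $P$. Then: (1) there are a poset $Q$ and a model structure on the category $Q$ (with finite limits and colimits, but not necessarily all small ones) such that $P$ is isomorphic, as a category, to a connected component of the subcategory of weak equivalences of $Q$ (the subcategory with all objects of $Q$ and with the weak equivalences as its morphisms; a component of a category is a maximal connected full subcategory); (2) $P$ is fibrant in the category $\mathbf{Pos}$ of posets, that is, the map from $P$ to the one-point poset is a fibration, where an order-preserving map $f$ is called a fibration if $\mathrm{Ex}^2 N f$ is a Kan fibration of simplicial sets ($N$ is the nerve and $\mathrm{Ex}$ is the right adjoint of the barycentric subdivision functor $\mathrm{Sd}$ on simplicial sets); (3) $P$ is contractible, that is, its classifying space (the geometric realization of $NP$) is a contractible topological space. -/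

import Mathlib

universe u

open CategoryTheory Limits HomotopicalAlgebra

/-- A morphism of small categories is a fibration (in the Thomason model structure) if
applying `Ex² ∘ N` to it yields a Kan fibration of simplicial sets. -/
def CategoryTheory.Cat.thomasonFibrations : MorphismProperty Cat.{u, u} :=
  (SSet.modelCategoryQuillen.J.{u}.rlp).inverseImage (nerveFunctor.{u, u} ⋙ SSet.ex ⋙ SSet.ex)

/-- The full and faithful functor `U` regarding a poset as a category. -/
def PartOrd.toCat : PartOrd.{u} ⥤ Cat.{u, u} :=
  forget₂ PartOrd.{u} Preord.{u} ⋙ preordToCat.{u}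

/-- An order preserving map of posets is a fibration if it is one when considered as a functor. -/
instance PartOrd.categoryWithFibrations : CategoryWithFibrations PartOrd.{u} where
  fibrations := Cat.thomasonFibrations.inverseImage PartOrd.toCat

/-- The one-point poset is terminal, so that there is a notion of fibrant poset,
`HomotopicalAlgebra.IsFibrant`. -/
instance PartOrd.hasTerminal : HasTerminal PartOrd.{u} :=
  IsTerminal.hasTerminal (X := PartOrd.of PUnit.{u + 1})
    (IsTerminal.ofUniqueHom (fun _ => PartOrd.ofHom ⟨fun _ => PUnit.unit, fun _ _ _ => le_rfl⟩)
      (fun _ _ => rfl))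

/-- `P`, regarded as a category, is (isomorphic to) a connected component of the subcategory of
weak equivalences of a model structure on some poset `Q`. -/
def IsComponentOfWeakEquivalences (P : Type u) [PartialOrder P] : Prop :=
  ∃ (Q : Type u) (_ : PartialOrder Q) (_ : ModelCategory Q)
    (j : ConnectedComponents (WideSubcategory (weakEquivalences Q))),
    Nonempty (Cat.of.{u, u} P ≅ Cat.of.{u, u} j.Component)

/-- The classifying space of a poset: the geometric realization of its nerve. -/
noncomputable def classifyingSpace (P : Type u) [PartialOrder P] : TopCat.{u} :=
  SSet.toTop.{u}.obj (nerve P)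

/-! ### Model structures on a poset -/

section PosetModelCategory

variable {Q : Type u} [PartialOrder Q]

/-- The morphism property of a poset given by a relation. -/
def MorphismProperty.ofRel (r : Q → Q → Prop) : MorphismProperty Q := fun x y _ => r x y

/-- The relation `a ≤ b` lifts against `x ≤ y` in a poset. -/
def LiftsLE (a b x y : Q) : Prop := a ≤ x → b ≤ y → b ≤ x

lemma hasLiftingProperty_of_liftsLE {a b x y : Q} (h : LiftsLE a b x y) (i : a ⟶ b) (p : x ⟶ y) :
    HasLiftingProperty i p :=
  ⟨fun {f g} _ => ⟨⟨{ l := homOfLE (h (leOfHom f) (leOfHom g))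
                      fac_left := Subsingleton.elim _ _
                      fac_right := Subsingleton.elim _ _ }⟩⟩⟩

lemma isStableUnderRetracts_ofRel {r : Q → Q → Prop} :
    (MorphismProperty.ofRel r).IsStableUnderRetracts where
  of_retract {X Y Z W f g} h hg := by
    have h1 : X = Z := le_antisymm (leOfHom h.i.left) (leOfHom h.r.left)
    have h2 : Y = W := le_antisymm (leOfHom h.i.right) (leOfHom h.r.right)
    subst h1 h2
    exact hg

/-- The relation of lifting on the left against all pairs related by `r`. -/
def leftLifts (r : Q → Q → Prop) (a b : Q) : Prop :=
  a ≤ b ∧ ∀ x y, r x y → LiftsLE a b x y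

/-- The relation of lifting on the right against all pairs related by `r`. -/
def rightLifts (r : Q → Q → Prop) (x y : Q) : Prop :=
  x ≤ y ∧ ∀ a b, r a b → LiftsLE a b x y

/-- A model structure on a poset from the relations of weak equivalences and of trivial
fibrations. -/
@[reducible]
def modelCategoryOfRel [HasFiniteLimits Q] [HasFiniteColimits Q] (w t : Q → Q → Prop)
    (w_trans : ∀ x y z, x ≤ y → y ≤ z → w x y → w y z → w x z)
    (w_left : ∀ x y z, x ≤ y → y ≤ z → w y z → w x z → w x y)
    (w_right : ∀ x y z, x ≤ y → y ≤ z → w x y → w x z → w y z)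
    (t_le : ∀ x y, t x y → x ≤ y) (t_w : ∀ x y, t x y → w x y)
    (fac₁ : ∀ x y, x ≤ y → ∃ z, leftLifts t x z ∧ t z y)
    (fac₂ : ∀ x y, x ≤ y → ∃ z, (leftLifts t x z ∧ w x z) ∧
      rightLifts (fun a b => leftLifts t a b ∧ w a b) z y) :
    ModelCategory Q :=
  { categoryWithWeakEquivalences := ⟨MorphismProperty.ofRel w⟩
    categoryWithCofibrations := ⟨MorphismProperty.ofRel (leftLifts t)⟩
    categoryWithFibrations :=
      ⟨MorphismProperty.ofRel (rightLifts fun a b => leftLifts t a b ∧ w a b)⟩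
    cm2 :=
      { comp_mem f g hf hg := w_trans _ _ _ (leOfHom f) (leOfHom g) hf hg
        of_postcomp f g hg hfg := w_left _ _ _ (leOfHom f) (leOfHom g) hg hfg
        of_precomp f g hf hfg := w_right _ _ _ (leOfHom f) (leOfHom g) hf hfg }
    cm3a := isStableUnderRetracts_ofRel
    cm3b := isStableUnderRetracts_ofRel
    cm3c := isStableUnderRetracts_ofRel
    cm4a i p hi hw hp := hasLiftingProperty_of_liftsLE (hp.mem.2 _ _ ⟨hi.mem, hw.mem⟩) i p
    cm4b {A B X Y} i p hi hp hw := by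
      refine hasLiftingProperty_of_liftsLE (hi.mem.2 _ _ ?_) i p
      -- Retract argument: the first factor of `p` is a trivial cofibration, so it lifts against
      -- `p`. This forces `z = X`, and `p` is in `t`.
      obtain ⟨z, hz, hzy⟩ := fac₁ X Y (leOfHom p)
      have hwz : w X z := w_left _ _ _ hz.1 (t_le _ _ hzy) (t_w _ _ hzy) hw.mem
      have : z ≤ X := hp.mem.2 _ _ ⟨hz, hwz⟩ le_rfl (t_le _ _ hzy)
      rwa [le_antisymm hz.1 this]
    cm5a := ⟨fun {X Y} f => by
      obtain ⟨z, hz, hzy⟩ := fac₂ X Y (leOfHom f)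
      exact ⟨{ Z := z
               i := homOfLE hz.1.1
               p := homOfLE hzy.1
               fac := Subsingleton.elim _ _
               hi := hz
               hp := hzy }⟩⟩
    cm5b := ⟨fun {X Y} f => by
      obtain ⟨z, hz, hzy⟩ := fac₁ X Y (leOfHom f)
      exact ⟨{ Z := z
               i := homOfLE hz.1
               p := homOfLE (t_le _ _ hzy)
               fac := Subsingleton.elim _ _
               hi := hz
               hp := ⟨⟨t_le _ _ hzy, fun a b hab => hab.1.2 _ _ hzy⟩, t_w _ _ hzy⟩ }⟩⟩ }

lemma hasFiniteLimits_of_isGLB [OrderTop Q] (h : ∀ a b : Q, ∃ m, IsGLB {a, b} m) :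
    HasFiniteLimits Q := by
  choose f hf using h
  let : SemilatticeInf Q :=
    { (inferInstance : PartialOrder Q) with
      inf := f
      inf_le_left := fun a b => (hf a b).1 (by simp)
      inf_le_right := fun a b => (hf a b).1 (by simp)
      le_inf := fun a b c hb hc => (hf b c).2 (by simp [hb, hc]) }
  infer_instance

lemma hasFiniteColimits_of_isLUB [OrderBot Q] (h : ∀ a b : Q, ∃ m, IsLUB {a, b} m) :
    HasFiniteColimits Q := by
  choose f hf using h
  let : SemilatticeSup Q :=
    { (inferInstance : PartialOrder Q) with
      sup := f
      le_sup_left := fun a b => (hf a b).1 (by simp)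
      le_sup_right := fun a b => (hf a b).1 (by simp)
      sup_le := fun a b c hb hc => (hf a b).2 (by simp [hb, hc]) }
  infer_instance

end PosetModelCategory

/-! ### The model structure on `P` with two ends adjoined -/

section Component

variable {P : Type u}

local notation "Q" => WithBot (WithTop P)

/-- The inclusion of a poset in the one with a least and a greatest element adjoined. -/
def inclBT (p : P) : Q := ((p : WithTop P) : Q)

@[simp]
lemma inclBT_le_inclBT [PartialOrder P] {p q : P} : inclBT p ≤ inclBT q ↔ p ≤ q := by simp [inclBT]

@[simp]
lemma inclBT_inj {p q : P} : inclBT p = inclBT q ↔ p = q := by simp [inclBT]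

@[simp]
lemma inclBT_ne_bot {p : P} : inclBT p ≠ ⊥ := by simp [inclBT]

@[simp]
lemma inclBT_ne_top {p : P} : inclBT p ≠ ⊤ := by
  rw [inclBT, ← WithBot.coe_top, Ne, WithBot.coe_inj]; simp

lemma inclBT_cases (x : Q) : x = ⊥ ∨ x = ⊤ ∨ ∃ p, x = inclBT p := by
  induction x using WithBot.recBotCoe with
  | bot => exact Or.inl rfl
  | coe x =>
    induction x using WithTop.recTopCoe with
    | top => exact Or.inr (Or.inl rfl)
    | coe p => exact Or.inr (Or.inr ⟨p, rfl⟩)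

lemma isGLB_pair_iff {α : Type*} [Preorder α] {a b m : α} :
    IsGLB {a, b} m ↔ m ≤ a ∧ m ≤ b ∧ ∀ x, x ≤ a → x ≤ b → x ≤ m := by
  simp [IsGLB, IsGreatest, mem_upperBounds, and_assoc]

lemma isLUB_pair_iff {α : Type*} [Preorder α] {a b m : α} :
    IsLUB {a, b} m ↔ a ≤ m ∧ b ≤ m ∧ ∀ x, a ≤ x → b ≤ x → m ≤ x := by
  simp [IsLUB, IsLeast, mem_lowerBounds, and_assoc]

/-- Two elements are weakly equivalent if they are equal or both lie in `P`. -/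
inductive WeakRel : Q → Q → Prop
  | refl (x : Q) : WeakRel x x
  | incl (p q : P) : WeakRel (inclBT p) (inclBT q)

lemma WeakRel.incl_left {p : P} {y : Q} (h : WeakRel (inclBT p) y) : ∃ q, y = inclBT q := by
  generalize hx : inclBT p = x at h
  cases h with
  | refl => exact ⟨p, hx.symm⟩
  | incl _ q => exact ⟨q, rfl⟩

lemma WeakRel.symm {x y : Q} (h : WeakRel x y) : WeakRel y x := by
  cases h <;> constructor

lemma WeakRel.trans {x y z : Q} (h : WeakRel x y) (h' : WeakRel y z) : WeakRel x z := by
  cases h with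
  | refl => exact h'
  | incl p q =>
    obtain ⟨r, rfl⟩ := h'.incl_left
    constructor

variable [PartialOrder P]

lemma exists_isGLB_BT (hmeet : ∀ a b : P, (∃ x, x ≤ a ∧ x ≤ b) → ∃ m, IsGLB {a, b} m) (x y : Q) :
    ∃ m, IsGLB {x, y} m := by
  simp only [isGLB_pair_iff] at hmeet ⊢
  obtain rfl | rfl | ⟨p, rfl⟩ := inclBT_cases x
  · exact ⟨⊥, by simp⟩
  · exact ⟨y, by simp⟩
  obtain rfl | rfl | ⟨q, rfl⟩ := inclBT_cases y
  · exact ⟨⊥, by simp⟩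
  · exact ⟨inclBT p, by simp +contextual⟩
  by_cases h : ∃ z, z ≤ p ∧ z ≤ q
  · obtain ⟨m, h1, h2, h3⟩ := hmeet p q h
    refine ⟨inclBT m, by simpa, by simpa, fun z hp hq => ?_⟩
    obtain rfl | rfl | ⟨z, rfl⟩ := inclBT_cases z
    · simp
    · simp at hp
    · simp_all
  · refine ⟨⊥, by simp, by simp, fun z hp hq => ?_⟩
    obtain rfl | rfl | ⟨z, rfl⟩ := inclBT_cases z
    · simp
    · simp at hp
    · exact absurd ⟨z, by simpa using hp, by simpa using hq⟩ h

lemma exists_isLUB_BT (hjoin : ∀ a b : P, (∃ x, a ≤ x ∧ b ≤ x) → ∃ j, IsLUB {a, b} j) (x y : Q) :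
    ∃ m, IsLUB {x, y} m := by
  simp only [isLUB_pair_iff] at hjoin ⊢
  obtain rfl | rfl | ⟨p, rfl⟩ := inclBT_cases x
  · exact ⟨y, by simp⟩
  · exact ⟨⊤, by simp +contextual⟩
  obtain rfl | rfl | ⟨q, rfl⟩ := inclBT_cases y
  · exact ⟨inclBT p, by simp +contextual⟩
  · exact ⟨⊤, by simp +contextual⟩
  by_cases h : ∃ z, p ≤ z ∧ q ≤ z
  · obtain ⟨m, h1, h2, h3⟩ := hjoin p q h
    refine ⟨inclBT m, by simpa, by simpa, fun z hp hq => ?_⟩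
    obtain rfl | rfl | ⟨z, rfl⟩ := inclBT_cases z
    · simp at hp
    · simp
    · simp_all
  · refine ⟨⊤, by simp, by simp, fun z hp hq => ?_⟩
    obtain rfl | rfl | ⟨z, rfl⟩ := inclBT_cases z
    · simp at hp
    · simp
    · exact absurd ⟨z, by simpa using hp, by simpa using hq⟩ h

/-- The trivial fibrations are the identities and the pairs `p ≤ q` in `P` such that each lower
bound of `c` and `q` is less than `p`. -/
inductive TrivFibRel (c : P) : Q → Q → Prop
  | refl (x : Q) : TrivFibRel c x x
  | incl (p q : P) (hpq : p ≤ q) (h : ∀ z, z ≤ c → z ≤ q → z ≤ p) :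
    TrivFibRel c (inclBT p) (inclBT q)

/-- The hypothesis expresses `b = a ∨ (c ∧ b)` through upper bounds only. Against a trivial
fibration `p ≤ q` with `a ≤ p` and `b ≤ q`, one has `c ∧ b ≤ c ∧ q ≤ p`, hence `b ≤ p`. -/
lemma leftLifts_trivFibRel_incl {c a b : P} (hab : a ≤ b)
    (h : ∀ u, a ≤ u → (∀ z, z ≤ c → z ≤ b → z ≤ u) → b ≤ u) :
    leftLifts (TrivFibRel c) (inclBT a) (inclBT b) := by
  refine ⟨by simpa, fun x y hxy => ?_⟩
  cases hxy with
  | refl => exact fun _ h => h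
  | incl p q hpq hz =>
    intro h1 h2
    simp only [inclBT_le_inclBT] at h1 h2 ⊢
    exact h p h1 fun z hc hb => hz z hc (hb.trans h2)

/-- Take `z = x ∨ (c ∧ y)`, which exists because `y` bounds both terms. The last clause, minimality
of `z`, serves to show that `c ∨ x ≤ ⊤` is a fibration. -/
lemma exists_fac_incl {c : P} (hc : ∀ x : P, ∃ m, IsGLB {c, x} m)
    (hjoin : ∀ a b : P, (∃ x, a ≤ x ∧ b ≤ x) → ∃ j, IsLUB {a, b} j) {x y : P} (hxy : x ≤ y) :
    ∃ z, leftLifts (TrivFibRel c) (inclBT x) (inclBT z) ∧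
      TrivFibRel c (inclBT z) (inclBT y) ∧
        ∀ u, x ≤ u → (∀ v, v ≤ c → v ≤ y → v ≤ u) → z ≤ u := by
  obtain ⟨m, hm⟩ := hc y
  rw [isGLB_pair_iff] at hm
  obtain ⟨z, hz⟩ := hjoin x m ⟨y, hxy, hm.2.1⟩
  rw [isLUB_pair_iff] at hz
  refine ⟨z, leftLifts_trivFibRel_incl hz.1 fun u hu h => ?_,
    .incl _ _ (hz.2.2 _ hxy hm.2.1) fun v h1 h2 => ?_, fun u hu h => ?_⟩
  · exact hz.2.2 _ hu (h m hm.1 hz.2.1)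
  · exact (hm.2.2 v h1 h2).trans hz.2.1
  · exact hz.2.2 _ hu (h m hm.1 hm.2.1)

lemma leftLifts_trivFibRel_top {c : P} (x : Q) : leftLifts (TrivFibRel c) x ⊤ := by
  refine ⟨le_top, fun u v huv => ?_⟩
  cases huv with
  | refl => exact fun _ h => h
  | incl p q => intro _ h; simp at h

/-- The model structure on the poset `P` with a least and a greatest element adjoined. -/
@[reducible]
def modelCategoryBT (c : P) (hc : ∀ x : P, (∃ m, IsGLB {c, x} m) ∧ (∃ j, IsLUB {c, x} j))
    (hmeet : ∀ a b : P, (∃ x, x ≤ a ∧ x ≤ b) → ∃ m, IsGLB {a, b} m)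
    (hjoin : ∀ a b : P, (∃ x, a ≤ x ∧ b ≤ x) → ∃ j, IsLUB {a, b} j) : ModelCategory Q :=
  haveI := hasFiniteLimits_of_isGLB (exists_isGLB_BT hmeet)
  haveI := hasFiniteColimits_of_isLUB (exists_isLUB_BT hjoin)
  modelCategoryOfRel WeakRel (TrivFibRel c)
    (fun _ _ _ _ _ h h' => h.trans h') (fun _ _ _ _ _ h h' => h'.trans h.symm)
    (fun _ _ _ _ _ h h' => h.symm.trans h')
    (fun _ _ h => by cases h <;> simp [*])
    (fun _ _ h => by cases h <;> constructor)
    (fun x y hxy => by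
      obtain rfl | rfl | ⟨y, rfl⟩ := inclBT_cases y
      · obtain rfl := le_bot_iff.1 hxy
        exact ⟨⊥, ⟨le_rfl, fun _ _ _ h _ => h⟩, .refl _⟩
      · exact ⟨⊤, leftLifts_trivFibRel_top _, .refl _⟩
      obtain rfl | rfl | ⟨x, rfl⟩ := inclBT_cases x
      · obtain ⟨m, hm⟩ := (hc y).1
        rw [isGLB_pair_iff] at hm
        -- Here `m = c ∧ y`. As `m ≤ c`, any trivial fibration whose target is above `m` has its
        -- source above `m`.
        refine ⟨inclBT m, ⟨bot_le, fun u v huv => ?_⟩, .incl _ _ hm.2.1 hm.2.2⟩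
        cases huv with
        | refl => exact fun _ h => h
        | incl p q hpq hz =>
          intro _ h
          simp only [inclBT_le_inclBT] at h ⊢
          exact hz _ hm.1 h
      · simp at hxy
      · obtain ⟨z, hz, hzy, -⟩ :=
          exists_fac_incl (fun x => (hc x).1) hjoin (inclBT_le_inclBT.1 hxy)
        exact ⟨_, hz, hzy⟩)
    (fun x y hxy => by
      obtain rfl | rfl | ⟨x, rfl⟩ := inclBT_cases x
      · refine ⟨⊥, ⟨⟨le_rfl, fun _ _ _ h _ => h⟩, .refl _⟩, bot_le, fun a b hab h _ => ?_⟩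
        obtain rfl := le_bot_iff.1 h
        have := hab.2
        generalize hx : (⊥ : Q) = x at this
        cases this with
        | refl => exact le_rfl
        | incl p q => exact absurd hx.symm inclBT_ne_bot
      · obtain rfl := top_le_iff.1 hxy
        exact ⟨⊤, ⟨leftLifts_trivFibRel_top _, .refl _⟩, le_rfl, fun _ _ _ _ _ => le_top⟩
      obtain rfl | rfl | ⟨y, rfl⟩ := inclBT_cases y
      · simp at hxy
      · obtain ⟨z, hz⟩ := (hc x).2
        rw [isLUB_pair_iff] at hz
        refine ⟨inclBT z, ⟨leftLifts_trivFibRel_incl hz.2.1 fun u hu h => ?_, .incl _ _⟩,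
          le_top, fun a b hab haz _ => ?_⟩
        · exact hz.2.2 _ (h c le_rfl hz.1) hu
        · obtain ⟨hab, hw⟩ := hab
          cases hw with
          | refl => exact haz
          | incl a b =>
            simp only [inclBT_le_inclBT] at haz ⊢
            -- With `u = a ∨ (c ∧ b)`, lifting `a ≤ b` against `u ≤ b` gives `b ≤ u`; and `u ≤ z = c
            -- ∨ x` since `a ≤ z` and `c ≤ z`.
            obtain ⟨u, hu, huy, hu'⟩ :=
              exists_fac_incl (fun x => (hc x).1) hjoin (inclBT_le_inclBT.1 hab.1)
            exact (inclBT_le_inclBT.1 (hab.2 _ _ huy hu.1 le_rfl)).trans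
              (hu' _ haz fun v hv _ => hv.trans hz.1)
      · obtain ⟨z, hz, hzy, -⟩ :=
          exists_fac_incl (fun x => (hc x).1) hjoin (inclBT_le_inclBT.1 hxy)
        exact ⟨_, ⟨hz, .incl _ _⟩, by cases hzy <;> simp [*], fun a b hab => hab.1.2 _ _ hzy⟩)

theorem isComponentOfWeakEquivalences
    (hc : ∃ c : P, ∀ x : P, (∃ m, IsGLB {c, x} m) ∧ (∃ j, IsLUB {c, x} j))
    (hmeet : ∀ a b : P, (∃ x, x ≤ a ∧ x ≤ b) → ∃ m, IsGLB {a, b} m)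
    (hjoin : ∀ a b : P, (∃ x, a ≤ x ∧ b ≤ x) → ∃ j, IsLUB {a, b} j) :
    IsComponentOfWeakEquivalences P := by
  obtain ⟨c, hc⟩ := hc
  let M : ModelCategory Q := modelCategoryBT c hc hmeet hjoin
  refine ⟨Q, inferInstance, M, ?_⟩
  let toW (p : P) : WideSubcategory (weakEquivalences Q) := ⟨inclBT p⟩
  let mapW {p q : P} (h : p ≤ q) : toW p ⟶ toW q :=
    ⟨homOfLE (inclBT_le_inclBT.2 h), .incl _ _⟩
  have hzig (p : P) : CategoryTheory.ConnectedComponents.mk (toW p) =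
      CategoryTheory.ConnectedComponents.mk (toW c) := by
    obtain ⟨m, hm⟩ := (hc p).1
    rw [isGLB_pair_iff] at hm
    exact Quotient.sound' (Zigzag.of_inv_hom (mapW hm.2.1) (mapW hm.1))
  have hmem (x : WideSubcategory (weakEquivalences Q))
      (hx : CategoryTheory.ConnectedComponents.mk x = CategoryTheory.ConnectedComponents.mk (toW c)) :
      ∃ p, x.obj = inclBT p := by
    -- `WeakRel` is an equivalence relation, so no zigzag leaves `P`.
    have h (y : WideSubcategory (weakEquivalences Q)) (hxy : Zigzag x y) :
        WeakRel x.obj y.obj := by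
      induction hxy with
      | refl => exact .refl _
      | tail _ h ih =>
        obtain ⟨⟨f⟩⟩ | ⟨⟨f⟩⟩ := h
        · exact ih.trans f.2
        · exact ih.trans (WeakRel.symm f.2)
    exact (h _ (Quotient.exact' hx)).symm.incl_left
  let F : P ⥤ (CategoryTheory.ConnectedComponents.mk (toW c)).Component :=
    { obj p := ⟨toW p, hzig p⟩
      map f := ⟨mapW (leOfHom f)⟩
      map_id _ := rfl
      map_comp _ _ := rfl }
  let G : (CategoryTheory.ConnectedComponents.mk (toW c)).Component ⥤ P :=
    { obj x := (hmem x.obj x.property).choose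
      map {x y} f := homOfLE (by
        have h := leOfHom f.hom.hom
        rw [(hmem x.obj x.property).choose_spec, (hmem y.obj y.property).choose_spec] at h
        simpa using h)
      map_id _ := rfl
      map_comp _ _ := rfl }
  have hFG (x) : F.obj (G.obj x) = x := by
    obtain ⟨⟨x⟩, hx⟩ := x
    have := (hmem ⟨x⟩ hx).choose_spec
    exact ObjectProperty.FullSubcategory.ext (WideSubcategory.ext this.symm)
  have hGF (p) : G.obj (F.obj p) = p :=
    (inclBT_inj.1 (hmem (toW p) (hzig p)).choose_spec).symm
  have h₁ : F ⋙ G = 𝟭 P :=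
    CategoryTheory.Functor.ext hGF fun _ _ _ => Subsingleton.elim _ _
  have h₂ : G ⋙ F = 𝟭 _ := CategoryTheory.Functor.ext hFG fun _ _ _ =>
    ObjectProperty.hom_ext _ (WideSubcategory.hom_ext _ (Subsingleton.elim _ _))
  exact ⟨CategoryTheory.ConnectedComponents.mk (toW c),
    ⟨{ hom := F.toCatHom
       inv := G.toCatHom
       hom_inv_id := Cat.ext h₁
       inv_hom_id := Cat.ext h₂ }⟩⟩

end Component

/-! ### Faces of a simplex and maps into `Ex (N P)` -/

section Subdivision

open Opposite Simplicial PartialOrder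

/-- The poset of faces of the standard simplex. -/
abbrev SimplexCategory.Faces (m : SimplexCategory) : Type u :=
  NonemptyFiniteChains (ULift.{u} (Fin (m.len + 1)))

namespace SimplexCategory.Faces

variable {a b m n : SimplexCategory}

/-- The face consisting of all vertices. -/
def full (m : SimplexCategory) : Faces.{u} m where
  finset := Finset.univ
  comparable a b := le_total a.1 b.1

/-- A nonempty set of vertices, as a face. -/
def ofFinset (s : Finset (ULift.{u} (Fin (m.len + 1)))) (hs : s.Nonempty) : Faces.{u} m where
  finset := s
  nonempty := hs
  comparable a b := le_total a.1 b.1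

/-- The monotone map induced on faces. -/
noncomputable def push (θ : a ⟶ m) : Faces.{u} a →o Faces.{u} m :=
  NonemptyFiniteChains.orderHomMap (toPartOrd.{u}.map θ).hom

lemma mem_push {θ : a ⟶ m} {S : Faces.{u} a} {x : ULift.{u} (Fin (m.len + 1))} :
    x ∈ (push θ S).finset ↔ ∃ i, i ∈ S.finset ∧ θ.toOrderHom i.down = x.down := by
  have : x ∈ (push θ S).finset ↔ ∃ i, i ∈ S.finset ∧ ULift.up (θ.toOrderHom i.down) = x :=
    NonemptyFiniteChains.mem_map_iff _ _ _
  rw [this]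
  simp only [ULift.ext_iff]

/-- The image of a map of simplices, as a face. -/
noncomputable def img (θ : a ⟶ m) : Faces.{u} m := push θ (full a)

lemma mem_img {θ : a ⟶ m} {x : ULift.{u} (Fin (m.len + 1))} :
    x ∈ (img θ).finset ↔ ∃ i, θ.toOrderHom i = x.down := by
  rw [img, mem_push]
  exact ⟨fun ⟨i, _, h⟩ => ⟨_, h⟩, fun ⟨i, h⟩ => ⟨⟨i⟩, Finset.mem_univ _, h⟩⟩

lemma push_comp (θ : a ⟶ b) (η : b ⟶ m) (S : Faces.{u} a) :
    push (θ ≫ η) S = push η (push θ S) := by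
  ext x
  simp only [mem_push]
  constructor
  · rintro ⟨i, hi, h⟩
    exact ⟨⟨θ.toOrderHom i.down⟩, ⟨i, hi, rfl⟩, h⟩
  · rintro ⟨j, ⟨i, hi, h⟩, h'⟩
    exact ⟨i, hi, by rw [← h', ← h]; rfl⟩

lemma push_le_img (θ : a ⟶ m) (S : Faces.{u} a) : push θ S ≤ img θ :=
  (push θ).monotone (Finset.subset_univ _)

lemma exists_fac {θ : a ⟶ m} {η : b ⟶ m} (h : img.{u} θ ≤ img η) : ∃ ρ : a ⟶ b, ρ ≫ η = θ := by
  have h' (i : Fin (a.len + 1)) : ∃ j, η.toOrderHom j = θ.toOrderHom i :=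
    mem_img.1 (h (mem_img.2 ⟨i, rfl⟩) : (⟨θ.toOrderHom i⟩ : ULift.{u} _) ∈ (img η).finset)
  classical
  -- The least preimage depends only on the value of `θ` at `i`, so equal values get equal
  -- preimages; this is what makes `r` monotone.
  let r (i : Fin (a.len + 1)) : Fin (b.len + 1) := Fin.find _ (h' i)
  have hr (i) : η.toOrderHom (r i) = θ.toOrderHom i := Fin.find_spec (h' i)
  have mono : Monotone r := by
    intro i i' hii'
    obtain heq | hlt := (θ.toOrderHom.monotone hii').eq_or_lt
    · have : r i = r i' := by simp only [r, heq]
      exact this.le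
    · by_contra! hc
      have := η.toOrderHom.monotone hc.le
      rw [hr, hr] at this
      exact absurd this (not_le.2 hlt)
  exact ⟨SimplexCategory.Hom.mk ⟨r, mono⟩,
    SimplexCategory.Hom.ext _ _ (OrderHom.ext _ _ (funext hr))⟩

lemma exists_img_eq (S : Faces.{u} m) :
    ∃ (a : SimplexCategory) (θ : a ⟶ m), Function.Injective θ.toOrderHom ∧ img θ = S := by
  classical
  let s : Finset (Fin (m.len + 1)) := S.finset.image ULift.down
  have hs : s.card = s.card - 1 + 1 := by
    have : s.card ≠ 0 := by simp [s, Finset.nonempty_iff_ne_empty.1 S.nonempty]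
    omega
  let e := s.orderEmbOfFin hs
  refine ⟨⦋s.card - 1⦌, SimplexCategory.Hom.mk e.toOrderHom, e.injective, ?_⟩
  ext x
  rw [mem_img]
  have : (∃ i, e i = x.down) ↔ x.down ∈ s := by
    have := Finset.range_orderEmbOfFin s hs
    rw [← Finset.mem_coe, ← this]
    rfl
  refine this.trans ?_
  simp [s]

lemma push_injective {θ : a ⟶ m} (h : Function.Injective θ.toOrderHom) :
    Function.Injective (push.{u} θ) := by
  intro S T hST
  ext x
  have key : ∀ S : Faces.{u} a, x ∈ S.finset ↔
      (⟨θ.toOrderHom x.down⟩ : ULift.{u} _) ∈ (push θ S).finset := by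
    intro S
    rw [mem_push]
    exact ⟨fun hx => ⟨x, hx, rfl⟩, fun ⟨i, hi, h'⟩ => by
      have : i = x := ULift.ext _ _ (h h')
      rwa [← this]⟩
  rw [key, key, hST]

lemma exists_push_eq {θ : a ⟶ m} {S : Faces.{u} m} (hS : S ≤ img θ) : ∃ T, push θ T = S := by
  classical
  let t : Finset (ULift.{u} (Fin (a.len + 1))) :=
    Finset.univ.filter fun i => (⟨θ.toOrderHom i.down⟩ : ULift.{u} _) ∈ S.finset
  have ht : ∀ x ∈ S.finset, ∃ i ∈ t, θ.toOrderHom i.down = x.down := by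
    intro x hx
    obtain ⟨i, hi⟩ := mem_img.1 (hS hx)
    refine ⟨⟨i⟩, ?_, hi⟩
    simp only [t, Finset.mem_filter, Finset.mem_univ, true_and, hi]
    exact hx
  obtain ⟨x, hx⟩ := S.nonempty
  obtain ⟨i, hi, -⟩ := ht x hx
  refine ⟨ofFinset t ⟨i, hi⟩, ?_⟩
  ext y
  rw [mem_push]
  refine ⟨?_, fun hy => ht y hy⟩
  rintro ⟨j, hj, hjy⟩
  have := (Finset.mem_filter.1 hj).2
  rw [hjy] at this
  exact this

lemma push_le_push_iff {θ : a ⟶ m} (h : Function.Injective θ.toOrderHom) {S T : Faces.{u} a} :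
    push θ S ≤ push θ T ↔ S ≤ T := by
  refine ⟨fun hST x hx => ?_, fun h => (push θ).monotone h⟩
  obtain ⟨i, hi, h'⟩ := mem_push.1
    (hST (mem_push.2 ⟨x, hx, rfl⟩) : (⟨θ.toOrderHom x.down⟩ : ULift.{u} _) ∈ _)
  have : i = x := ULift.ext _ _ (h h')
  rwa [← this]

end SimplexCategory.Faces

section NerveMaps

variable {A : Type u} [PartialOrder A] {P : Type u} [PartialOrder P]

/-- The value at a vertex of a map between nerves. -/
def nerveVal (f : nerve A ⟶ nerve P) (x : A) : P :=
  ComposableArrows.left (n := 0) (f.app (op ⦋0⦌) (ComposableArrows.mk₀ x))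

/-- Naturality along the inclusion of the `i`-th vertex: a map of nerves is determined by its values
at vertices. -/
lemma nerve_app_obj (f : nerve A ⟶ nerve P) {m : SimplexCategory} (σ : (nerve A).obj (op m))
    (i : Fin (m.len + 1)) :
    CategoryTheory.Functor.obj (f.app (op m) σ) i = nerveVal f (CategoryTheory.Functor.obj σ i) := by
  have h := f.naturality_apply (SimplexCategory.const ⦋0⦌ m i).op σ
  have h1 : (nerve A).map (SimplexCategory.const ⦋0⦌ m i).op σ =
      ComposableArrows.mk₀ (CategoryTheory.Functor.obj σ i) := ComposableArrows.ext₀ rfl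
  rw [h1] at h
  exact (congrArg (fun F : ComposableArrows P 0 => F.obj 0) h).symm

lemma nerveVal_mono (f : nerve A ⟶ nerve P) : Monotone (nerveVal f) := by
  intro x y h
  have := leOfHom (CategoryTheory.Functor.map (f.app (op ⦋1⦌) (ComposableArrows.mk₁ (homOfLE h)))
    (homOfLE (Fin.zero_le 1) : (0 : Fin 2) ⟶ 1))
  exact (nerve_app_obj f (m := ⦋1⦌) (ComposableArrows.mk₁ (homOfLE h)) 0).symm.trans_le
    (this.trans (nerve_app_obj f (m := ⦋1⦌) (ComposableArrows.mk₁ (homOfLE h)) 1).le)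

lemma nerve_hom_ext {f g : nerve A ⟶ nerve P} (h : ∀ x, nerveVal f x = nerveVal g x) : f = g := by
  refine NatTrans.ext (funext fun m => ConcreteCategory.hom_ext _ _ fun σ => ?_)
  refine nerve.ext_of_isThin (C := P) (funext fun i => ?_)
  exact (nerve_app_obj f σ i).trans ((h _).trans (nerve_app_obj g σ i).symm)

end NerveMaps

section Ex

open SimplexCategory

variable {P : Type u} [PartialOrder P]

/-- The map `N (Faces m) ⟶ N P` corresponding to a simplex of `Ex (N P)`. -/
def exDown {X : SSet.{u}} {m : SimplexCategory} (z : (SSet.ex.obj X).obj (op m)) :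
    nerve (Faces.{u} m) ⟶ X := z.down

/-- The simplex of `Ex X` corresponding to a map `N (Faces m) ⟶ X`. -/
def exUp {X : SSet.{u}} {m : SimplexCategory} (z : nerve (Faces.{u} m) ⟶ X) :
    (SSet.ex.obj X).obj (op m) := ULift.up z

lemma exDown_injective {X : SSet.{u}} {m : SimplexCategory} :
    Function.Injective (exDown (X := X) (m := m)) := ULift.down_injective

lemma exDown_map {X : SSet.{u}} {a m : SimplexCategory} (θ : a ⟶ m)
    (z : (SSet.ex.obj X).obj (op m)) :
    exDown ((SSet.ex.obj X).map θ.op z) =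
      nerveMap (Faces.push.{u} θ).monotone.functor ≫ exDown z := rfl

/-- The value of a simplex of `Ex (N P)` on the face of all vertices. -/
def exTop {m : SimplexCategory} (z : (SSet.ex.obj (nerve P)).obj (op m)) : P :=
  nerveVal (exDown z) (Faces.full m)

lemma exTop_map {a m : SimplexCategory} (θ : a ⟶ m) (z : (SSet.ex.obj (nerve P)).obj (op m)) :
    exTop ((SSet.ex.obj (nerve P)).map θ.op z) = nerveVal (exDown z) (Faces.img θ) := by
  rw [exTop, exDown_map]
  rfl

lemma exTop_map_le {a m : SimplexCategory} (θ : a ⟶ m)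
    (z : (SSet.ex.obj (nerve P)).obj (op m)) :
    exTop ((SSet.ex.obj (nerve P)).map θ.op z) ≤ exTop z := by
  rw [exTop_map]
  exact nerveVal_mono _ (Finset.subset_univ _)

/-- Every face is the image of some `θ`, so the value of `z` at that face is the top value of a
restriction of `z`. -/
lemma ex_ext {m : SimplexCategory} {z z' : (SSet.ex.obj (nerve P)).obj (op m)}
    (h : ∀ (a : SimplexCategory) (θ : a ⟶ m), exTop ((SSet.ex.obj (nerve P)).map θ.op z) =
      exTop ((SSet.ex.obj (nerve P)).map θ.op z')) : z = z' := by
  refine exDown_injective (nerve_hom_ext fun S => ?_)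
  obtain ⟨a, θ, -, rfl⟩ := Faces.exists_img_eq S
  simpa only [exTop_map] using h a θ

lemma ex_hom_ext {K : SSet.{u}} {f g : K ⟶ SSet.ex.obj (nerve P)}
    (h : ∀ (m : SimplexCategory) (k : K.obj (op m)), exTop (f.app _ k) = exTop (g.app _ k)) :
    f = g := by
  refine NatTrans.ext (funext fun ⟨m⟩ => ConcreteCategory.hom_ext _ _ fun k => ex_ext fun a θ => ?_)
  rw [← f.naturality_apply, ← g.naturality_apply]
  exact h _ _

section Lift

variable {K : SSet.{u}} (φ : ∀ m : SimplexCategory, K.obj (op m) → P)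

lemma map_le_map_of_img_le
    (hφ : ∀ (a m : SimplexCategory) (θ : a ⟶ m) (k : K.obj (op m)), φ a (K.map θ.op k) ≤ φ m k)
    {a b m : SimplexCategory} {θ : a ⟶ m} {η : b ⟶ m}
    (h : Faces.img.{u} θ ≤ Faces.img η) (k : K.obj (op m)) :
    φ a (K.map θ.op k) ≤ φ b (K.map η.op k) := by
  obtain ⟨ρ, rfl⟩ := Faces.exists_fac h
  rw [op_comp, K.map_comp]
  exact hφ _ _ _ _

/-- A map to `Ex (N P)` is given by a function on simplices that decreases under restriction. -/
lemma exists_hom_ex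
    (hφ : ∀ (a m : SimplexCategory) (θ : a ⟶ m) (k : K.obj (op m)), φ a (K.map θ.op k) ≤ φ m k) :
    ∃ f : K ⟶ SSet.ex.obj (nerve P),
      ∀ (m : SimplexCategory) (k : K.obj (op m)), exTop (f.app _ k) = φ m k := by
  choose a θ hθ himg using fun (m : SimplexCategory) (S : Faces.{u} m) => Faces.exists_img_eq S
  -- The value at a face is `φ` of the restriction to that face; by `map_le_map_of_img_le` the
  -- choice of parametrization is immaterial.
  let F (m : SimplexCategory) (k : K.obj (op m)) : Faces.{u} m → P :=
    fun S => φ _ (K.map (θ m S).op k)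
  have hF (m : SimplexCategory) (k : K.obj (op m)) : Monotone (F m k) := fun S T hST =>
    map_le_map_of_img_le φ hφ (by rwa [himg, himg]) k
  let z (m : SimplexCategory) (k : K.obj (op m)) : (SSet.ex.obj (nerve P)).obj (op m) :=
    exUp (nerveMap (hF m k).functor)
  have hz (b m : SimplexCategory) (k : K.obj (op m)) (η : b ⟶ m) :
      exTop ((SSet.ex.obj (nerve P)).map η.op (z m k)) = φ b (K.map η.op k) := by
    rw [exTop_map]
    change F m k (Faces.img η) = _
    exact le_antisymm (map_le_map_of_img_le φ hφ (himg _ _).le k)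
      (map_le_map_of_img_le φ hφ (himg _ _).ge k)
  refine ⟨{ app m := ↾fun k => z m.unop k, naturality := ?_ }, fun m k => ?_⟩
  · rintro ⟨m⟩ ⟨b⟩ ⟨η⟩
    refine ConcreteCategory.hom_ext _ _ fun k => ex_ext fun d ρ => ?_
    change exTop ((SSet.ex.obj (nerve P)).map ρ.op (z b (K.map η.op k))) =
      exTop ((SSet.ex.obj (nerve P)).map ρ.op ((SSet.ex.obj (nerve P)).map η.op (z m k)))
    rw [hz, ← ConcreteCategory.comp_apply, ← ConcreteCategory.comp_apply, ← K.map_comp,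
      ← Functor.map_comp, ← op_comp, hz]
  · change exTop (z m k) = _
    have := hz m m k (𝟙 m)
    rwa [op_id, CategoryTheory.Functor.map_id, CategoryTheory.Functor.map_id] at this

end Lift

end Ex

end Subdivision

/-! ### Extension of maps into `Ex² (N P)` and fibrancy -/

section Extension

open Opposite Simplicial PartialOrder SimplexCategory

/-- The map induced on the nerves of the posets of faces. -/
noncomputable def pushNerve {a m : SimplexCategory} (θ : a ⟶ m) :
    nerve (Faces.{u} a) ⟶ nerve (Faces.{u} m) :=
  nerveMap (Faces.push.{u} θ).monotone.functor

/-- The vertices of a simplex of the nerve of a poset. -/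
def nerveVertex {A : Type u} [PartialOrder A] {m : SimplexCategory} (σ : (nerve A).obj (op m))
    (i : Fin (m.len + 1)) : A :=
  CategoryTheory.Functor.obj σ i

lemma nerveVertex_mono {A : Type u} [PartialOrder A] {m : SimplexCategory}
    (σ : (nerve A).obj (op m)) : Monotone (nerveVertex σ) :=
  fun _ _ h => leOfHom (CategoryTheory.Functor.map σ (homOfLE h))

lemma nerve_ext {A : Type u} [PartialOrder A] {m : SimplexCategory} {σ τ : (nerve A).obj (op m)}
    (h : ∀ i, nerveVertex σ i = nerveVertex τ i) : σ = τ :=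
  nerve.ext_of_isThin (C := A) (funext h)

lemma nerveVertex_pushNerve {a k m : SimplexCategory} (θ : a ⟶ k)
    (σ : (nerve (Faces.{u} a)).obj (op m)) (i : Fin (m.len + 1)) :
    nerveVertex ((pushNerve θ).app _ σ) i = Faces.push θ (nerveVertex σ i) := rfl

lemma pushNerve_injective {a k m : SimplexCategory} {θ : a ⟶ k}
    (h : Function.Injective θ.toOrderHom) {σ τ : (nerve (Faces.{u} a)).obj (op m)}
    (hστ : (pushNerve θ).app _ σ = (pushNerve θ).app _ τ) : σ = τ :=
  nerve_ext fun i => Faces.push_injective h (congrArg (nerveVertex · i) hστ)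

lemma pushNerve_comp {a b k m : SimplexCategory} (θ : a ⟶ b) (η : b ⟶ k)
    (σ : (nerve (Faces.{u} a)).obj (op m)) :
    (pushNerve (θ ≫ η)).app _ σ = (pushNerve η).app _ ((pushNerve θ).app _ σ) :=
  nerve_ext fun _ => Faces.push_comp _ _ _

lemma exists_pushNerve_eq {a k m : SimplexCategory} {θ : a ⟶ k}
    (h : Function.Injective θ.toOrderHom) (σ : (nerve (Faces.{u} k)).obj (op m))
    (hσ : nerveVertex σ (Fin.last _) ≤ Faces.img θ) :
    ∃ τ, (pushNerve θ).app _ τ = σ := by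
  choose f hf using fun i =>
    Faces.exists_push_eq ((nerveVertex_mono σ (Fin.le_last i)).trans hσ)
  have hmono : Monotone f := fun i j hij => by
    rw [← Faces.push_le_push_iff h, hf, hf]
    exact nerveVertex_mono σ hij
  exact ⟨hmono.functor, nerve_ext hf⟩

variable {P : Type u} [PartialOrder P] {n : SimplexCategory}

/-- Functions on the chains of faces that belong to a sieve extend to all chains of faces. -/
lemma exists_extension {c : P} (hc : ∀ x : P, ∃ j, IsLUB {c, x} j)
    (M : ∀ k, (k ⟶ n) → Prop) (hM : ∀ a k (ρ : a ⟶ k) (θ : k ⟶ n), M k θ → M a (ρ ≫ θ))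
    (φ : ∀ k (θ : k ⟶ n), M k θ → ∀ m : SimplexCategory, (nerve (Faces.{u} k)).obj (op m) → P)
    (hφ : ∀ a k (ρ : a ⟶ k) (θ : k ⟶ n) (h : M k θ) (m : SimplexCategory)
      (σ : (nerve (Faces.{u} a)).obj (op m)),
      φ a (ρ ≫ θ) (hM _ _ _ _ h) m σ = φ k θ h m ((pushNerve ρ).app _ σ))
    (hφ' : ∀ k (θ : k ⟶ n) (h : M k θ) (a m : SimplexCategory) (ρ : a ⟶ m)
      (σ : (nerve (Faces.{u} k)).obj (op m)),
      φ k θ h a ((nerve (Faces.{u} k)).map ρ.op σ) ≤ φ k θ h m σ) :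
    ∃ ψ : ∀ m : SimplexCategory, (nerve (Faces.{u} n)).obj (op m) → P,
      (∀ (a m : SimplexCategory) (ρ : a ⟶ m) (σ : (nerve (Faces.{u} n)).obj (op m)),
        ψ a ((nerve (Faces.{u} n)).map ρ.op σ) ≤ ψ m σ) ∧
      ∀ k (θ : k ⟶ n) (h : M k θ) (m : SimplexCategory) (σ : (nerve (Faces.{u} k)).obj (op m)),
        ψ m ((pushNerve θ).app _ σ) = φ k θ h m σ := by
  classical
  have M_of_le {a k : SimplexCategory} {η : a ⟶ n} {θ : k ⟶ n} (h : Faces.img.{u} η ≤ Faces.img θ)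
      (hθ : M k θ) : M a η := by
    obtain ⟨ρ, rfl⟩ := Faces.exists_fac h
    exact hM _ _ _ _ hθ
  choose b η hη himg using fun S : Faces.{u} n => Faces.exists_img_eq S
  let inM (S : Faces.{u} n) : Prop := M _ (η S)
  have inM_img {k : SimplexCategory} {θ : k ⟶ n} (hθ : M k θ) : inM (Faces.img θ) :=
    M_of_le (himg _).le hθ
  have inM_mono {S T : Faces.{u} n} (hST : S ≤ T) (hT : inM T) : inM S :=
    M_of_le (by rwa [himg, himg]) hT
  have lifts {m : SimplexCategory} (σ : (nerve (Faces.{u} n)).obj (op m)) :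
      ∃ τ, (pushNerve (η (nerveVertex σ (Fin.last _)))).app _ τ = σ :=
    exists_pushNerve_eq (hη _) σ (himg _).ge
  choose τ hτ using @lifts
  let v {m : SimplexCategory} (σ : (nerve (Faces.{u} n)).obj (op m))
      (hσ : inM (nerveVertex σ (Fin.last _))) : P := φ _ _ hσ m (τ σ)
  -- `v` does not depend on the parametrization, even for a non-injective `θ`. Restrict to the top
  -- face of `σ` by `ζ`; then `ζ ≫ θ` factors through the chosen injection, along which chains lift
  -- uniquely.
  have hv {k m : SimplexCategory} (θ : k ⟶ n) (h : M k θ)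
      (σ : (nerve (Faces.{u} k)).obj (op m))
      (hσ : inM (nerveVertex ((pushNerve θ).app _ σ) (Fin.last _))) :
      v ((pushNerve θ).app _ σ) hσ = φ k θ h m σ := by
    obtain ⟨g, ζ, hζ, hζ'⟩ := Faces.exists_img_eq (nerveVertex σ (Fin.last _))
    obtain ⟨σ', rfl⟩ := exists_pushNerve_eq hζ σ hζ'.ge
    rw [← hφ]
    have hle : Faces.img.{u} (ζ ≫ θ) ≤
        Faces.img (η (nerveVertex ((pushNerve θ).app _ ((pushNerve ζ).app _ σ')) (Fin.last _))) := by
      rw [himg, nerveVertex_pushNerve, ← hζ', Faces.img, Faces.img, Faces.push_comp]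
    obtain ⟨ρ, hρ⟩ := Faces.exists_fac hle
    have h₁ : φ g (ζ ≫ θ) (hM _ _ _ _ h) m σ' = φ _ _ hσ m ((pushNerve ρ).app _ σ') := by
      rw [← hφ]
      congr 1
      exact hρ.symm
    rw [h₁]
    change φ _ _ hσ m _ = _
    congr 1
    refine pushNerve_injective (hη _) ?_
    refine (hτ _).trans ?_
    refine (pushNerve_comp ζ θ σ').symm.trans ?_
    refine Eq.trans ?_ (pushNerve_comp ρ _ σ')
    rw [hρ]
  have inM_map {a m : SimplexCategory} (ρ : a ⟶ m) (σ : (nerve (Faces.{u} n)).obj (op m))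
      (hσ : inM (nerveVertex σ (Fin.last _))) :
      inM (nerveVertex ((nerve (Faces.{u} n)).map ρ.op σ) (Fin.last _)) :=
    inM_mono (nerveVertex_mono σ (Fin.le_last _)) hσ
  have v_map {a m : SimplexCategory} (ρ : a ⟶ m) (σ : (nerve (Faces.{u} n)).obj (op m))
      (hσ : inM (nerveVertex σ (Fin.last _)))
      (hσ' : inM (nerveVertex ((nerve (Faces.{u} n)).map ρ.op σ) (Fin.last _))) :
      v ((nerve (Faces.{u} n)).map ρ.op σ) hσ' ≤ v σ hσ := by
    have h₁ : (nerve (Faces.{u} n)).map ρ.op σ = (pushNerve (η (nerveVertex σ (Fin.last _)))).app _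
        ((nerve (Faces.{u} _)).map ρ.op (τ σ)) := by
      rw [NatTrans.naturality_apply, hτ]
    have h₂ : v ((nerve (Faces.{u} n)).map ρ.op σ) hσ' =
        φ _ _ hσ _ ((nerve (Faces.{u} _)).map ρ.op (τ σ)) := by
      generalize (nerve (Faces.{u} n)).map ρ.op σ = σ' at h₁ hσ' ⊢
      subst h₁
      exact hv _ hσ _ _
    rw [h₂]
    exact hφ' _ _ _ _ _ _ _
  -- The values already prescribed on the restrictions of `σ` that lie in the sieve.
  let V {m : SimplexCategory} (σ : (nerve (Faces.{u} n)).obj (op m)) : Set P :=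
    {p | ∃ (a : SimplexCategory) (ρ : a ⟶ m)
      (h : inM (nerveVertex ((nerve (Faces.{u} n)).map ρ.op σ) (Fin.last _))), v _ h = p}
  have V_mono {a m : SimplexCategory} (ρ : a ⟶ m) (σ : (nerve (Faces.{u} n)).obj (op m)) :
      V ((nerve (Faces.{u} n)).map ρ.op σ) ⊆ V σ := by
    rintro _ ⟨d, ζ, h, rfl⟩
    have h₁ : (nerve (Faces.{u} n)).map ζ.op ((nerve (Faces.{u} n)).map ρ.op σ) =
        (nerve (Faces.{u} n)).map (ζ ≫ ρ).op σ := nerve_ext fun _ => rfl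
    generalize (nerve (Faces.{u} n)).map ζ.op ((nerve (Faces.{u} n)).map ρ.op σ) = σ' at h₁ h ⊢
    subst h₁
    exact ⟨_, _, h, rfl⟩
  -- The members of the chain lying in the sieve form a subchain through which every restriction in
  -- the sieve factors; its value is the greatest.
  have hV {m : SimplexCategory} (σ : (nerve (Faces.{u} n)).obj (op m)) (hσ : (V σ).Nonempty) :
      ∃ p, IsGreatest (V σ) p := by
    let s : Finset (ULift.{u} (Fin (m.len + 1))) :=
      Finset.univ.filter fun i => inM (nerveVertex σ i.down)
    have hs {i} : i ∈ s ↔ inM (nerveVertex σ i.down) := by simp [s]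
    have key {a : SimplexCategory} (ρ : a ⟶ m)
        (h : inM (nerveVertex ((nerve (Faces.{u} n)).map ρ.op σ) (Fin.last _)))
        (i : Fin (a.len + 1)) : ULift.up (ρ.toOrderHom i) ∈ s :=
      hs.2 (inM_mono (nerveVertex_mono ((nerve (Faces.{u} n)).map ρ.op σ) (Fin.le_last i)) h)
    have hne : s.Nonempty := by
      obtain ⟨_, a, ρ, h, -⟩ := hσ
      exact ⟨_, key ρ h 0⟩
    obtain ⟨a, ρ, -, hρ⟩ := Faces.exists_img_eq (Faces.ofFinset s hne)
    have h₀ : inM (nerveVertex ((nerve (Faces.{u} n)).map ρ.op σ) (Fin.last _)) := by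
      have : (ULift.up (ρ.toOrderHom (Fin.last _)) : ULift.{u} _) ∈ (Faces.img ρ).finset :=
        Faces.mem_img.2 ⟨_, rfl⟩
      rw [hρ] at this
      exact hs.1 this
    refine ⟨v _ h₀, ⟨a, ρ, h₀, rfl⟩, ?_⟩
    rintro _ ⟨d, ζ, h, rfl⟩
    obtain ⟨ξ, rfl⟩ := Faces.exists_fac (θ := ζ) (η := ρ) (by
      rw [hρ]
      intro x hx
      obtain ⟨i, hi⟩ := Faces.mem_img.1 hx
      have := key ζ h i
      rw [hi] at this
      exact this)
    exact v_map ξ ((nerve (Faces.{u} n)).map ρ.op σ) h₀ h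
  have hlub {m : SimplexCategory} (σ : (nerve (Faces.{u} n)).obj (op m)) :
      ∃ p, IsLUB (insert c (V σ)) p := by
    by_cases hσ : (V σ).Nonempty
    · obtain ⟨p, hp⟩ := hV σ hσ
      obtain ⟨q, hq⟩ := hc p
      refine ⟨q, ?_⟩
      rw [isLUB_pair_iff] at hq
      refine ⟨?_, fun r hr => hq.2.2 r (hr (Set.mem_insert _ _)) (hr (Set.mem_insert_of_mem _ hp.1))⟩
      rintro x (rfl | hx)
      · exact hq.1
      · exact (hp.2 hx).trans hq.2.1
    · rw [Set.not_nonempty_iff_eq_empty.1 hσ]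
      exact ⟨c, by simp⟩
  choose w hw using @hlub
  -- Joining with `c` gives a value even when nothing is prescribed, and `w` decreases under
  -- restriction because `V` does.
  let ψ (m : SimplexCategory) (σ : (nerve (Faces.{u} n)).obj (op m)) : P :=
    if h : inM (nerveVertex σ (Fin.last _)) then v σ h else w σ
  refine ⟨ψ, fun a m ρ σ => ?_, fun k θ h m σ => ?_⟩
  · by_cases h : inM (nerveVertex σ (Fin.last _))
    · have h' := inM_map ρ σ h
      simp only [ψ, dif_pos h, dif_pos h']
      exact v_map _ _ _ _
    · simp only [ψ, dif_neg h]
      split_ifs with h'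
      · exact (hw σ).1 (Set.mem_insert_of_mem _ ⟨a, ρ, h', rfl⟩)
      · exact (hw _).2 fun x hx => (hw σ).1 (Set.insert_subset_insert (V_mono ρ σ) hx)
  · have h' : inM (nerveVertex ((pushNerve θ).app _ σ) (Fin.last _)) :=
      inM_mono (Faces.push_le_img _ _) (inM_img h)
    simp only [ψ, dif_pos h']
    exact hv _ _ _ _

/-- Maps from a subcomplex of a standard simplex to `Ex² (N P)` extend to the simplex. -/
lemma exists_extension_exEx {c : P} (hc : ∀ x : P, ∃ j, IsLUB {c, x} j)
    (A : (SSet.stdSimplex.{u}.obj n).Subcomplex)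
    (u : (A : SSet.{u}) ⟶ SSet.ex.obj (SSet.ex.obj (nerve P))) :
    ∃ f : SSet.stdSimplex.{u}.obj n ⟶ SSet.ex.obj (SSet.ex.obj (nerve P)), A.ι ≫ f = u := by
  -- The subcomplex `A`, seen as a sieve on `n`.
  let M (k : SimplexCategory) (θ : k ⟶ n) : Prop :=
    SSet.stdSimplex.objEquiv.symm θ ∈ A.obj (op k)
  have hM (a k : SimplexCategory) (ρ : a ⟶ k) (θ : k ⟶ n) (h : M k θ) : M a (ρ ≫ θ) :=
    A.map ρ.op h
  let φ (k : SimplexCategory) (θ : k ⟶ n) (h : M k θ) (m : SimplexCategory)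
      (σ : (nerve (Faces.{u} k)).obj (op m)) : P :=
    exTop ((exDown (u.app (op k) ⟨_, h⟩)).app (op m) σ)
  obtain ⟨ψ, hψ, hψ'⟩ := exists_extension hc M hM φ
    (fun a k ρ θ h m σ => by
      have h₁ := u.naturality_apply ρ.op ⟨_, h⟩
      have h₂ := exDown_map ρ (u.app (op k) ⟨_, h⟩)
      rw [← h₁] at h₂
      exact congrArg (fun f : nerve (Faces.{u} a) ⟶ SSet.ex.obj (nerve P) =>
        exTop (f.app (op m) σ)) h₂)
    (fun k θ h a m ρ σ => by
      simp only [φ, NatTrans.naturality_apply]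
      exact exTop_map_le _ _)
  obtain ⟨g, hg⟩ := exists_hom_ex ψ hψ
  refine ⟨SSet.yonedaEquiv.symm (exUp g), NatTrans.ext (funext fun ⟨k⟩ =>
    ConcreteCategory.hom_ext _ _ ?_)⟩
  rintro ⟨x, hx⟩
  obtain ⟨θ, rfl⟩ := SSet.stdSimplex.objEquiv.symm.surjective x
  refine exDown_injective (ex_hom_ext fun m σ => ?_)
  exact (hg m _).trans (hψ' k θ hx m σ)

theorem isFibrant_of_exists_isLUB (hc : ∃ c : P, ∀ x : P, ∃ j, IsLUB {c, x} j) :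
    IsFibrant (PartOrd.of P) := by
  obtain ⟨c, hc⟩ := hc
  refine ⟨?_⟩
  change SSet.modelCategoryQuillen.J.rlp (SSet.ex.map (SSet.ex.map (nerveMap _)))
  intro X Y i hi
  simp only [SSet.modelCategoryQuillen.J, MorphismProperty.iSup_iff] at hi
  obtain ⟨n, ⟨i⟩⟩ := hi
  refine ⟨fun {f g} _ => ?_⟩
  obtain ⟨l, hl⟩ := exists_extension_exEx (P := P) hc _ f
  have hT : Subsingleton (⊤_ PartOrd.{u} : PartOrd.{u}) := by
    let e : (⊤_ PartOrd.{u}) ≅ PartOrd.of PUnit.{u + 1} :=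
      terminalIsTerminal.uniqueUpToIso (IsTerminal.ofUniqueHom
        (fun _ => PartOrd.ofHom ⟨fun _ => PUnit.unit, fun _ _ _ => le_rfl⟩) (fun _ _ => rfl))
    refine ⟨fun x y => ?_⟩
    have h : (e.hom ≫ e.inv) x = (e.hom ≫ e.inv) y := congrArg e.inv (Subsingleton.elim _ _)
    simpa using h
  refine ⟨⟨{ l := l, fac_left := hl, fac_right := ?_ }⟩⟩
  refine NatTrans.ext (funext fun ⟨k⟩ => ConcreteCategory.hom_ext _ _ fun x => ?_)
  refine exDown_injective ?_
  refine ex_hom_ext (P := (⊤_ PartOrd.{u} : PartOrd.{u})) fun m σ => hT.elim _ _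

end Extension

/-! ### Points of the realization of a nerve -/

section Realization

open Opposite Simplicial

/-- The point of the geometric realization given by a simplex and barycentric coordinates. -/
noncomputable def realizePt {X : SSet.{u}} {n : ℕ} (x : X _⦋n⦌) :
    C(stdSimplex ℝ (Fin (n + 1)), SSet.toTop.obj X) :=
  TopCat.toSSetObjEquiv _ _ ((sSetTopAdj.unit.app X).app _ x)

lemma realizePt_map {X : SSet.{u}} {n m : ℕ} (x : X _⦋n⦌) (θ : ⦋m⦌ ⟶ ⦋n⦌)
    (t : stdSimplex ℝ (Fin (m + 1))) :
    realizePt (X.map θ.op x) t = realizePt x (stdSimplex.map θ.toOrderHom t) := by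
  have h := (sSetTopAdj.unit.app X).naturality_apply θ.op x
  exact congrArg (fun y => TopCat.toSSetObjEquiv _ (op ⦋m⦌) y t) h

/-- A compatible family of continuous maps on topological simplices glues to the realization. -/
lemma exists_continuousMap_toTop {X : SSet.{u}} {Y : Type u} [TopologicalSpace Y]
    (f : ∀ (n : ℕ), X _⦋n⦌ → C(stdSimplex ℝ (Fin (n + 1)), Y))
    (hf : ∀ (n m : ℕ) (x : X _⦋n⦌) (θ : ⦋m⦌ ⟶ ⦋n⦌) (t : stdSimplex ℝ (Fin (m + 1))),
      f m (X.map θ.op x) t = f n x (stdSimplex.map θ.toOrderHom t)) :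
    ∃ g : C(SSet.toTop.obj X, Y), ∀ (n : ℕ) (x : X _⦋n⦌) (t), g (realizePt x t) = f n x t := by
  let φ : X ⟶ TopCat.toSSet.obj (TopCat.of Y) :=
    { app n := ↾fun x => (TopCat.toSSetObjEquiv (TopCat.of Y) n).symm (f n.unop.len x)
      naturality := by
        rintro ⟨n⟩ ⟨m⟩ ⟨θ⟩
        refine ConcreteCategory.hom_ext _ _ fun x => ?_
        refine (TopCat.toSSetObjEquiv (TopCat.of Y) _).injective (ContinuousMap.ext fun t => ?_)
        exact hf n.len m.len x θ t }
  refine ⟨((sSetTopAdj.homEquiv _ _).symm φ).hom, fun n x t => ?_⟩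
  have h := (sSetTopAdj.homEquiv X (TopCat.of Y)).apply_symm_apply φ
  rw [Adjunction.homEquiv_unit] at h
  have h' := congrArg (fun g : X ⟶ TopCat.toSSet.obj (TopCat.of Y) =>
    TopCat.toSSetObjEquiv _ _ (g.app (op ⦋n⦌) x) t) h
  exact h'

lemma toTop_hom_ext {X : SSet.{u}} {Y : Type u} [TopologicalSpace Y]
    {f g : C(SSet.toTop.obj X, Y)}
    (h : ∀ (n : ℕ) (x : X _⦋n⦌) (t), f (realizePt x t) = g (realizePt x t)) : f = g := by
  have : TopCat.ofHom f = TopCat.ofHom g := by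
    refine (sSetTopAdj.homEquiv _ _).injective ?_
    rw [Adjunction.homEquiv_unit, Adjunction.homEquiv_unit]
    refine NatTrans.ext (funext fun ⟨n⟩ => ConcreteCategory.hom_ext _ _ fun x =>
      (TopCat.toSSetObjEquiv (TopCat.of Y) _).injective (ContinuousMap.ext fun t => ?_))
    exact h n.len x t
  exact congrArg TopCat.Hom.hom this

variable {P : Type u}

/-- The weight on `P` of a weighted chain. -/
noncomputable def chainWeight {n : ℕ} (x : Fin (n + 1) → P) (t : Fin (n + 1) → ℝ) (p : P) : ℝ :=
  open Classical in ∑ i, if x i = p then t i else 0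

lemma stdSimplex_map_apply {n m : ℕ} (θ : Fin (m + 1) → Fin (n + 1))
    (t : stdSimplex ℝ (Fin (m + 1))) (i : Fin (n + 1)) :
    stdSimplex.map θ t i = ∑ j with θ j = i, t j := by
  rw [stdSimplex.map_coe, FunOnFinite.linearMap_apply_apply]

lemma sum_filter_sum_fiber {n m : ℕ} (θ : Fin (m + 1) → Fin (n + 1)) (t : Fin (m + 1) → ℝ)
    (q : Fin (n + 1) → Prop) [DecidablePred q] :
    ∑ i with q i, ∑ j with θ j = i, t j = ∑ j with q (θ j), t j := by
  simp only [Finset.sum_filter]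
  have (i : Fin (n + 1)) : (if q i then ∑ j, (if θ j = i then t j else 0) else 0) =
      ∑ j, if θ j = i then (if q (θ j) then t j else 0) else 0 := by
    split_ifs with h
    · exact Finset.sum_congr rfl fun j _ => by split_ifs <;> simp_all
    · exact (Finset.sum_eq_zero fun j _ => by split_ifs <;> simp_all).symm
  simp only [this]
  rw [Finset.sum_comm]
  simp

lemma chainWeight_sum_fiber {n m : ℕ} (x : Fin (n + 1) → P) (θ : Fin (m + 1) → Fin (n + 1))
    (t : Fin (m + 1) → ℝ) :
    chainWeight x (fun i => ∑ j with θ j = i, t j) = chainWeight (x ∘ θ) t := by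
  classical
  funext p
  have := sum_filter_sum_fiber θ t (fun i => x i = p)
  rw [Finset.sum_filter, Finset.sum_filter] at this
  simp only [chainWeight, Function.comp_apply]
  convert this

lemma chainWeight_comp {n m : ℕ} (x : Fin (n + 1) → P) (θ : Fin (m + 1) → Fin (n + 1))
    (t : stdSimplex ℝ (Fin (m + 1))) :
    chainWeight (x ∘ θ) t = chainWeight x (stdSimplex.map θ t) := by
  rw [← chainWeight_sum_fiber]
  exact congrArg _ (funext fun i => (stdSimplex_map_apply θ t i).symm)

lemma chainWeight_apply_of_injective {n : ℕ} {x : Fin (n + 1) → P} (hx : Function.Injective x)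
    (t : Fin (n + 1) → ℝ) (i : Fin (n + 1)) : chainWeight x t (x i) = t i := by
  simp [chainWeight, hx.eq_iff]

lemma chainWeight_apply_of_notMem {n : ℕ} {x : Fin (n + 1) → P} (t : Fin (n + 1) → ℝ) {p : P}
    (hp : p ∉ Set.range x) : chainWeight x t p = 0 :=
  Finset.sum_eq_zero fun i _ => if_neg fun h => hp ⟨i, h⟩

variable [PartialOrder P]

/-- The point of the realization of a nerve given by a chain and barycentric coordinates. -/
noncomputable def chainPt {n : ℕ} (x : Fin (n + 1) →o P) :
    C(stdSimplex ℝ (Fin (n + 1)), SSet.toTop.obj (nerve P)) :=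
  realizePt (X := nerve P) (n := n) (x.monotone.functor)

lemma chainPt_comp {n m : ℕ} (x : Fin (n + 1) →o P) (θ : Fin (m + 1) →o Fin (n + 1))
    (t : stdSimplex ℝ (Fin (m + 1))) :
    chainPt (x.comp θ) t = chainPt x (stdSimplex.map θ t) :=
  realizePt_map (X := nerve P) (x.monotone.functor) (SimplexCategory.Hom.mk θ) t

/-- The vertices of weight zero are discarded. -/
lemma exists_pos_chain {n : ℕ} (x : Fin (n + 1) →o P) (t : stdSimplex ℝ (Fin (n + 1))) :
    ∃ (m : ℕ) (y : Fin (m + 1) →o P) (s : stdSimplex ℝ (Fin (m + 1))), (∀ i, 0 < s i) ∧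
      chainPt x t = chainPt y s ∧ chainWeight x t = chainWeight y s := by
  classical
  let D : Finset (Fin (n + 1)) := Finset.univ.filter fun i => t i ≠ 0
  have hD : D.card = D.card - 1 + 1 := by
    have : D.Nonempty := by
      by_contra hD
      have h0 : ∀ i, t i = 0 := by
        simpa [D, Finset.filter_eq_empty_iff] using Finset.not_nonempty_iff_eq_empty.1 hD
      have := stdSimplex.sum_eq_one t
      simp [h0] at this
    have := this.card_pos
    omega
  let e := D.orderEmbOfFin hD
  have he (i) : i ∈ Set.range e ↔ t i ≠ 0 := by
    simp only [e, Finset.range_orderEmbOfFin]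
    simp [D]
  have hsum : ∑ j, t (e j) = 1 := by
    rw [← stdSimplex.sum_eq_one t]
    exact Fintype.sum_of_injective e e.injective _ _
      (fun i hi => not_not.1 fun h => hi ((he i).2 h)) fun _ => rfl
  let s : stdSimplex ℝ (Fin (D.card - 1 + 1)) :=
    ⟨fun j => t (e j), fun j => stdSimplex.zero_le _ _, hsum⟩
  have hs : stdSimplex.map e s = t := by
    refine stdSimplex.ext (funext fun i => ?_)
    rw [stdSimplex_map_apply, Finset.sum_filter]
    by_cases hi : i ∈ Set.range e
    · obtain ⟨j, rfl⟩ := hi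
      simp [e.injective.eq_iff]
      rfl
    · rw [Finset.sum_eq_zero fun j _ => if_neg fun h => hi ⟨j, h⟩]
      exact (not_not.1 fun h => hi ((he i).2 h)).symm
  refine ⟨_, x.comp e.toOrderHom, s, fun j => ?_, ?_, ?_⟩
  · exact lt_of_le_of_ne (stdSimplex.zero_le _ _) (Ne.symm ((he _).1 ⟨j, rfl⟩))
  · rw [chainPt_comp]
    exact congrArg _ hs.symm
  · have := chainWeight_comp x e s
    rw [hs] at this
    exact this.symm

/-- Once the weights are positive, repeated vertices are merged by pushing the weights forward to
the range of the chain. -/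
lemma exists_strictMono_chain {n : ℕ} (x : Fin (n + 1) →o P) (t : stdSimplex ℝ (Fin (n + 1))) :
    ∃ (m : ℕ) (y : Fin (m + 1) →o P) (s : stdSimplex ℝ (Fin (m + 1))), (∀ i, 0 < s i) ∧
      StrictMono y ∧ chainPt x t = chainPt y s ∧ chainWeight x t = chainWeight y s := by
  classical
  obtain ⟨n, x, t, ht, h₁, h₂⟩ := exists_pos_chain x t
  simp only [h₁, h₂]
  let C := Set.range x
  let _ : LinearOrder C :=
    { (inferInstance : PartialOrder C) with
      le_total := by
        rintro ⟨_, i, rfl⟩ ⟨_, j, rfl⟩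
        exact (le_total i j).imp (fun h => x.monotone h) (fun h => x.monotone h)
      toDecidableLE := Classical.decRel _ }
  have hC : Fintype.card C = Fintype.card C - 1 + 1 := by
    have : 0 < Fintype.card C := Fintype.card_pos_iff.2 ⟨⟨x 0, 0, rfl⟩⟩
    omega
  let e : Fin (Fintype.card C - 1 + 1) ≃o C := Fintype.orderIsoFinOfCardEq C hC
  let π : Fin (n + 1) →o Fin (Fintype.card C - 1 + 1) :=
    ⟨fun i => e.symm ⟨x i, i, rfl⟩, fun i j h => e.symm.monotone (x.monotone h)⟩
  let y : Fin (Fintype.card C - 1 + 1) →o P := ⟨fun j => (e j).1, fun i j h => e.monotone h⟩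
  have hxy : x = y.comp π := by
    refine OrderHom.ext _ _ (funext fun i => ?_)
    exact congrArg Subtype.val (e.apply_symm_apply ⟨x i, i, rfl⟩).symm
  refine ⟨_, y, stdSimplex.map π t, fun j => ?_, fun i j h => e.strictMono h, ?_, ?_⟩
  · obtain ⟨i, hi⟩ := (e j).2
    have hij : π i = j := by
      have : (⟨x i, i, rfl⟩ : C) = e j := Subtype.ext hi
      change e.symm ⟨x i, i, rfl⟩ = j
      rw [this]
      simp
    rw [stdSimplex_map_apply]
    exact Finset.sum_pos (fun k _ => ht k) ⟨i, by simp [hij]⟩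
  · rw [← chainPt_comp, ← hxy]
  · rw [← chainWeight_comp]
    exact congrArg (fun z : Fin (n + 1) →o P => chainWeight z t) hxy

/-- In reduced form the chain is the support of the weight function and the coordinates are its
values. Equalities of points thus reduce to equalities of functions on `P`. -/
lemma chainPt_eq_of_chainWeight_eq {n m : ℕ} {x : Fin (n + 1) →o P}
    {t : stdSimplex ℝ (Fin (n + 1))} {y : Fin (m + 1) →o P} {s : stdSimplex ℝ (Fin (m + 1))}
    (h : chainWeight x t = chainWeight y s) : chainPt x t = chainPt y s := by
  obtain ⟨n, x, t, ht, hx, h₁, h₂⟩ := exists_strictMono_chain x t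
  obtain ⟨m, y, s, hs, hy, h₃, h₄⟩ := exists_strictMono_chain y s
  rw [h₁, h₃]
  rw [h₂, h₄] at h
  have hrange : Set.range x = Set.range y := by
    refine Set.Subset.antisymm ?_ ?_
    · rintro _ ⟨i, rfl⟩
      by_contra hi
      have := chainWeight_apply_of_notMem s hi
      rw [← h, chainWeight_apply_of_injective hx.injective] at this
      exact (ht i).ne' this
    · rintro _ ⟨i, rfl⟩
      by_contra hi
      have := chainWeight_apply_of_notMem t hi
      rw [h, chainWeight_apply_of_injective hy.injective] at this
      exact (hs i).ne' this
  obtain rfl : n = m := by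
    have := congrArg Set.ncard hrange
    rw [← Set.image_univ, ← Set.image_univ, Set.ncard_image_of_injective _ hx.injective,
      Set.ncard_image_of_injective _ hy.injective, Set.ncard_univ, Set.ncard_univ] at this
    simpa using this
  obtain rfl : x = y := DFunLike.coe_injective ((hx.range_inj hy).1 hrange)
  obtain rfl : t = s := stdSimplex.ext (funext fun i => by
    rw [← chainWeight_apply_of_injective hx.injective (t : Fin (n + 1) → ℝ), h,
      chainWeight_apply_of_injective hx.injective])
  rfl

end Realization

/-! ### Comparable maps are homotopic; contractibility -/

section Homotopy

open Opposite Simplicial unitInterval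

/-- The part of the weight `t i` below the threshold `r`, when the weights `t 0, t 1, …` are
laid side by side. -/
noncomputable def lowerPart {n : ℕ} (t : Fin (n + 1) → ℝ) (r : ℝ) (i : Fin (n + 1)) : ℝ :=
  min (∑ j with j ≤ i, t j) r - min (∑ j with j < i, t j) r

/-- The part of the weight `t i` above the threshold `r`. -/
noncomputable def upperPart {n : ℕ} (t : Fin (n + 1) → ℝ) (r : ℝ) (i : Fin (n + 1)) : ℝ :=
  t i - lowerPart t r i

lemma sum_le_eq_sum_lt_add {n : ℕ} (t : Fin (n + 1) → ℝ) (i : Fin (n + 1)) :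
    ∑ j with j ≤ i, t j = (∑ j with j < i, t j) + t i := by
  have : (Finset.univ.filter fun j => j ≤ i) = insert i (Finset.univ.filter fun j => j < i) := by
    ext j
    simp [le_iff_eq_or_lt]
  rw [this, Finset.sum_insert (by simp), add_comm]

/-- On an initial segment the sum telescopes. -/
lemma sum_lowerPart {n : ℕ} (t : Fin (n + 1) → ℝ) {r : ℝ} (hr : 0 ≤ r)
    (D : Finset (Fin (n + 1))) (hD : ∀ i ∈ D, ∀ j < i, j ∈ D) :
    ∑ i ∈ D, lowerPart t r i = min (∑ i ∈ D, t i) r := by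
  induction D using Finset.induction_on_max with
  | empty => simp [hr]
  | insert a D ha ih =>
    have haD : a ∉ D := fun h => lt_irrefl _ (ha a h)
    have hDa : D = Finset.univ.filter fun j => j < a := by
      ext j
      simp only [Finset.mem_filter, Finset.mem_univ, true_and]
      refine ⟨ha j, fun hj => ?_⟩
      exact (Finset.mem_insert.1 (hD a (Finset.mem_insert_self _ _) j hj)).resolve_left hj.ne
    have h1 := ih fun i hi j hj => by
      rw [hDa] at hi ⊢
      simp only [Finset.mem_filter, Finset.mem_univ, true_and] at hi ⊢
      exact hj.trans hi
    rw [Finset.sum_insert haD, Finset.sum_insert haD, h1, lowerPart, sum_le_eq_sum_lt_add, hDa,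
      add_comm (t a)]
    ring

section

variable {n : ℕ} (t : stdSimplex ℝ (Fin (n + 1))) (r : I)

lemma lowerPart_nonneg (i : Fin (n + 1)) : 0 ≤ lowerPart t r i := by
  rw [lowerPart, sum_le_eq_sum_lt_add, sub_nonneg]
  exact min_le_min_right _ (le_add_of_nonneg_right (stdSimplex.zero_le _ _))

lemma upperPart_nonneg (i : Fin (n + 1)) : 0 ≤ upperPart t r i := by
  have h0 := stdSimplex.zero_le t i
  rw [upperPart, lowerPart, sum_le_eq_sum_lt_add]
  generalize ∑ j with j < i, t j = s
  have : min (s + t i) r ≤ min s r + t i := by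
    rw [← min_add_add_right]
    exact min_le_min_left _ (le_add_of_nonneg_right h0)
  linarith

lemma lowerPart_zero : lowerPart t 0 = 0 := by
  have h0 (p : Fin (n + 1) → Prop) [DecidablePred p] : 0 ≤ ∑ j with p j, t j :=
    Finset.sum_nonneg fun _ _ => stdSimplex.zero_le _ _
  funext i
  simp [lowerPart, h0]

lemma lowerPart_one : lowerPart t 1 = t := by
  have h1 (p : Fin (n + 1) → Prop) [DecidablePred p] : ∑ j with p j, t j ≤ 1 := by
    rw [← stdSimplex.sum_eq_one t]
    exact Finset.sum_le_sum_of_subset_of_nonneg (Finset.filter_subset _ _)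
      fun _ _ _ => stdSimplex.zero_le _ _
  funext i
  rw [lowerPart, min_eq_left (h1 _), min_eq_left (h1 _), sum_le_eq_sum_lt_add, add_sub_cancel_left]

lemma exists_threshold : ∃ k : Fin (n + 1), ∑ j with j < k, t j ≤ r ∧ r ≤ ∑ j with j ≤ k, t j := by
  have hlast : (r : ℝ) ≤ ∑ j with j ≤ Fin.last n, t j := by
    have : (Finset.univ.filter fun j => j ≤ Fin.last n) = Finset.univ := by
      ext j; simp [Fin.le_last]
    rw [this, stdSimplex.sum_eq_one]
    exact r.2.2
  classical
  have hex : ∃ k : Fin (n + 1), (r : ℝ) ≤ ∑ j with j ≤ k, t j := ⟨_, hlast⟩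
  obtain ⟨k, hk, hmin⟩ := WellFounded.has_min (wellFounded_lt (α := Fin (n + 1)))
    {k | (r : ℝ) ≤ ∑ j with j ≤ k, t j} hex
  refine ⟨k, ?_, hk⟩
  induction k using Fin.cases with
  | zero => simpa using r.2.1
  | succ k =>
    have h := hmin k.castSucc
    have : (Finset.univ.filter fun j => j < k.succ) =
        Finset.univ.filter fun j => j ≤ k.castSucc := by
      ext j; simp [Fin.le_castSucc_iff]
    rw [this]
    by_contra! hc
    exact hmin k.castSucc hc.le (Fin.castSucc_lt_succ)

variable {t r}

lemma sum_le_sum_of_filter_le {p q : Fin (n + 1) → Prop} [DecidablePred p] [DecidablePred q]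
    (h : ∀ i, p i → q i) : ∑ j with p j, t j ≤ ∑ j with q j, t j :=
  Finset.sum_le_sum_of_subset_of_nonneg (Finset.monotone_filter_right _ fun i _ => h i)
    fun _ _ _ => stdSimplex.zero_le _ _

lemma lowerPart_eq_zero {k i : Fin (n + 1)} (hk : r ≤ ∑ j with j ≤ k, t j) (hi : k < i) :
    lowerPart t r i = 0 := by
  have h1 : r ≤ ∑ j with j < i, t j :=
    hk.trans (sum_le_sum_of_filter_le fun j hj => lt_of_le_of_lt hj hi)
  rw [lowerPart, min_eq_right h1,
    min_eq_right (h1.trans (sum_le_sum_of_filter_le fun j hj => hj.le)), sub_self]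

lemma upperPart_eq_zero {k i : Fin (n + 1)} (hk : ∑ j with j < k, t j ≤ r) (hi : i < k) :
    upperPart t r i = 0 := by
  have h1 : ∑ j with j ≤ i, t j ≤ r :=
    (sum_le_sum_of_filter_le fun j hj => lt_of_le_of_lt hj hi).trans hk
  rw [upperPart, lowerPart, min_eq_left h1,
    min_eq_left ((sum_le_sum_of_filter_le fun j hj => hj.le).trans h1), sum_le_eq_sum_lt_add]
  ring

variable (t r)

/-- The lower and the upper parts of the weights, as barycentric coordinates. -/
noncomputable def splitPoint : stdSimplex ℝ (Fin (n + 1 + n + 1)) :=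
  -- `n + 1 + n + 1` unfolds to `(n + 1) + (n + 1)`; the first spelling has the form required by
  -- `chainPt`.
  ⟨Fin.append (m := n + 1) (n := n + 1) (lowerPart t r) (upperPart t r), by
    intro i
    induction i using Fin.addCases (m := n + 1) (n := n + 1) with
    | left i => rw [Fin.append_left]; exact lowerPart_nonneg t r i
    | right i => rw [Fin.append_right]; exact upperPart_nonneg t r i, by
    refine (Fin.sum_univ_add (a := n + 1) (b := n + 1) _).trans ?_
    simp only [Fin.append_left, Fin.append_right]
    rw [← Finset.sum_add_distrib, ← stdSimplex.sum_eq_one t]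
    exact Finset.sum_congr rfl fun i _ => by simp [upperPart]⟩

lemma continuous_splitPoint :
    Continuous fun z : stdSimplex ℝ (Fin (n + 1)) × I => splitPoint z.1 z.2 := by
  have hsum (D : Finset (Fin (n + 1))) :
      Continuous fun z : stdSimplex ℝ (Fin (n + 1)) × I => ∑ i ∈ D, z.1 i :=
    continuous_finsetSum _ fun i _ => (continuous_apply i).comp
      (continuous_subtype_val.comp continuous_fst)
  have hr : Continuous fun z : stdSimplex ℝ (Fin (n + 1)) × I => (z.2 : ℝ) :=
    continuous_subtype_val.comp continuous_snd
  have hl (i : Fin (n + 1)) :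
      Continuous fun z : stdSimplex ℝ (Fin (n + 1)) × I => lowerPart z.1 z.2 i :=
    ((hsum _).min hr).sub ((hsum _).min hr)
  refine Continuous.subtype_mk (continuous_pi fun i => ?_) _
  induction i using Fin.addCases (m := n + 1) (n := n + 1) with
  | left i => simpa only [Fin.append_left] using hl i
  | right i =>
    simp only [Fin.append_right]
    exact ((continuous_apply i).comp (continuous_subtype_val.comp continuous_fst)).sub (hl i)

/-- A fibre of a monotone map is a difference of two initial segments, to which `sum_lowerPart`
applies. -/
lemma lowerPart_map {m : ℕ} (θ : Fin (m + 1) →o Fin (n + 1)) (t : stdSimplex ℝ (Fin (m + 1)))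
    (i : Fin (n + 1)) :
    lowerPart (stdSimplex.map θ t) r i = ∑ j with θ j = i, lowerPart t r j := by
  rw [lowerPart]
  simp only [stdSimplex_map_apply]
  rw [sum_filter_sum_fiber, sum_filter_sum_fiber, ← sum_lowerPart _ r.2.1,
    ← sum_lowerPart _ r.2.1, sub_eq_iff_eq_add']
  · have : (Finset.univ.filter fun j => θ j ≤ i) =
        (Finset.univ.filter fun j => θ j < i) ∪ Finset.univ.filter fun j => θ j = i := by
      ext j; simp [le_iff_lt_or_eq]
    rw [this, Finset.sum_union]
    rw [Finset.disjoint_filter]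
    exact fun j _ h => h.ne
  · intro j hj k hk
    simp only [Finset.mem_filter, Finset.mem_univ, true_and] at hj ⊢
    exact (θ.monotone hk.le).trans_lt hj
  · intro j hj k hk
    simp only [Finset.mem_filter, Finset.mem_univ, true_and] at hj ⊢
    exact (θ.monotone hk.le).trans hj

end

variable {P : Type u} [PartialOrder P]

/-- The chain `f (x 0) ≤ … ≤ f (x k) ≤ g (x k) ≤ … ≤ g (x n)`, with repetitions. -/
def prismChain {f g : P →o P} (hfg : f ≤ g) {n : ℕ} (x : Fin (n + 1) →o P) (k : Fin (n + 1)) :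
    Fin (n + 1 + n + 1) →o P where
  toFun := Fin.append (m := n + 1) (n := n + 1) (fun i => f (x (min i k)))
    (fun i => g (x (max i k)))
  monotone' := by
    intro i j hij
    induction i using Fin.addCases (m := n + 1) (n := n + 1) with
    | left i =>
      induction j using Fin.addCases (m := n + 1) (n := n + 1) with
      | left j =>
        simp only [Fin.append_left]
        have : i ≤ j := Fin.le_def.2 (Fin.le_def.1 hij)
        exact f.monotone (x.monotone (min_le_min_right _ this))
      | right j =>
        simp only [Fin.append_left, Fin.append_right]
        exact (f.monotone (x.monotone ((min_le_right _ _).trans (le_max_right _ _)))).trans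
          (hfg _)
    | right i =>
      induction j using Fin.addCases (m := n + 1) (n := n + 1) with
      | left j =>
        have := Fin.le_def.1 hij
        simp at this
        omega
      | right j =>
        simp only [Fin.append_right]
        have : i ≤ j := Fin.le_def.2 (Nat.le_of_add_le_add_left (Fin.le_def.1 hij))
        exact g.monotone (x.monotone (max_le_max_right _ this))

/-- The entries altered by `min i k` and `max i k` carry weight zero. The result does not involve
`k`, so all admissible `k` give the same point. -/
lemma chainWeight_prismChain {f g : P →o P} (hfg : f ≤ g) {n : ℕ} (x : Fin (n + 1) →o P)
    (t : stdSimplex ℝ (Fin (n + 1))) (r : I) {k : Fin (n + 1)}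
    (hk : ∑ j with j < k, t j ≤ r) (hk' : r ≤ ∑ j with j ≤ k, t j) :
    chainWeight (prismChain hfg x k) (splitPoint t r) =
      chainWeight (f ∘ x) (lowerPart t r) + chainWeight (g ∘ x) (upperPart t r) := by
  funext p
  refine (Fin.sum_univ_add (a := n + 1) (b := n + 1) _).trans ?_
  rw [Pi.add_apply]
  refine congrArg₂ _ (Finset.sum_congr rfl fun i _ => ?_) (Finset.sum_congr rfl fun i _ => ?_)
  · have h1 : prismChain hfg x k (Fin.castAdd (n + 1) i) = f (x (min i k)) :=
      Fin.append_left (fun i => f (x (min i k))) (fun i => g (x (max i k))) i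
    have h2 : splitPoint t r (Fin.castAdd (n + 1) i) = lowerPart t r i :=
      Fin.append_left (m := n + 1) (n := n + 1) _ _ _
    rw [h1, h2]
    obtain hi | hi := le_or_gt i k
    · rw [min_eq_left hi]; rfl
    · rw [lowerPart_eq_zero hk' hi]; simp
  · have h1 : prismChain hfg x k (Fin.natAdd (n + 1) i) = g (x (max i k)) :=
      Fin.append_right (fun i => f (x (min i k))) (fun i => g (x (max i k))) i
    have h2 : splitPoint t r (Fin.natAdd (n + 1) i) = upperPart t r i :=
      Fin.append_right (m := n + 1) (n := n + 1) _ _ _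
    rw [h1, h2]
    obtain hi | hi := le_or_gt k i
    · rw [max_eq_left hi]; rfl
    · rw [upperPart_eq_zero hk hi]; simp

/-- The map is characterized by weights alone, so compatibility with faces and degeneracies can be
checked without following `k`. -/
lemma exists_prism {f g : P →o P} (hfg : f ≤ g) {n : ℕ} (x : Fin (n + 1) →o P) :
    ∃ h : C(stdSimplex ℝ (Fin (n + 1)) × I, SSet.toTop.obj (nerve P)),
      ∀ (t : stdSimplex ℝ (Fin (n + 1))) (r : I) (m : ℕ) (y : Fin (m + 1) →o P)
        (s : stdSimplex ℝ (Fin (m + 1))),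
        chainWeight y s =
          chainWeight (f ∘ x) (lowerPart t r) + chainWeight (g ∘ x) (upperPart t r) →
        h (t, r) = chainPt y s := by
  choose k hk hk' using fun z : stdSimplex ℝ (Fin (n + 1)) × I => exists_threshold z.1 z.2
  let h (z : stdSimplex ℝ (Fin (n + 1)) × I) : SSet.toTop.obj (nerve P) :=
    chainPt (prismChain hfg x (k z)) (splitPoint z.1 z.2)
  let R (k : Fin (n + 1)) : Set (stdSimplex ℝ (Fin (n + 1)) × I) :=
    {z | ∑ j with j < k, z.1 j ≤ z.2 ∧ z.2 ≤ ∑ j with j ≤ k, z.1 j}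
  have hsum (D : Finset (Fin (n + 1))) :
      Continuous fun z : stdSimplex ℝ (Fin (n + 1)) × I => ∑ i ∈ D, z.1 i :=
    continuous_finsetSum _ fun i _ => (continuous_apply i).comp
      (continuous_subtype_val.comp continuous_fst)
  have hr : Continuous fun z : stdSimplex ℝ (Fin (n + 1)) × I => (z.2 : ℝ) :=
    continuous_subtype_val.comp continuous_snd
  have hcont : Continuous h := by
    -- The closed sets where the threshold falls in block `i` cover the prism; on each, one fixed
    -- chain may be used.
    refine (locallyFinite_of_finite R).continuous ?_ (fun i => ?_) (fun i => ?_)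
    · exact Set.eq_univ_of_forall fun z => Set.mem_iUnion.2 ⟨k z, hk z, hk' z⟩
    · exact (isClosed_le (hsum _) hr).inter (isClosed_le hr (hsum _))
    · refine ContinuousOn.congr
        (f := fun z => chainPt (prismChain hfg x i) (splitPoint z.1 z.2)) ?_ fun z hz => ?_
      · exact ((ContinuousMap.continuous _).comp continuous_splitPoint).continuousOn
      · refine chainPt_eq_of_chainWeight_eq ?_
        rw [chainWeight_prismChain hfg x _ _ (hk z) (hk' z),
          chainWeight_prismChain hfg x _ _ hz.1 hz.2]
  refine ⟨⟨h, hcont⟩, fun t r m y s hys => ?_⟩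
  refine chainPt_eq_of_chainWeight_eq ?_
  rw [chainWeight_prismChain hfg x _ _ (hk (t, r)) (hk' (t, r)), hys]

lemma exists_toTop_map (f : P →o P) :
    ∃ F : C(SSet.toTop.obj (nerve P), SSet.toTop.obj (nerve P)),
      ∀ (n : ℕ) (x : Fin (n + 1) →o P) (t), F (chainPt x t) = chainPt (f.comp x) t := by
  obtain ⟨F, hF⟩ := exists_continuousMap_toTop (X := nerve P)
    (fun n x => chainPt (f.comp ⟨nerveVertex (m := ⦋n⦌) x, nerveVertex_mono x⟩))
    (fun n m x θ t =>
      chainPt_comp (f.comp ⟨nerveVertex (m := ⦋n⦌) x, nerveVertex_mono x⟩) θ.toOrderHom t)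
  exact ⟨F, fun n x t => hF n x.monotone.functor t⟩

lemma toTop_nerve_hom_ext {Y : Type u} [TopologicalSpace Y]
    {F G : C(SSet.toTop.obj (nerve P), Y)}
    (h : ∀ (n : ℕ) (x : Fin (n + 1) →o P) (t), F (chainPt x t) = G (chainPt x t)) : F = G := by
  refine toTop_hom_ext fun n x t => ?_
  have hx : realizePt x = chainPt ⟨nerveVertex (m := ⦋n⦌) x, nerveVertex_mono x⟩ :=
    congrArg realizePt (nerve_ext (m := ⦋n⦌) fun _ => rfl)
  rw [hx]
  exact h _ _ _

/-- The homotopy is glued as a map into the path space `C(I, _)`, so that only maps out of the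
realization itself are needed; it is uncurried afterwards since `I` is locally compact. -/
lemma homotopic_of_le {f g : P →o P} (hfg : f ≤ g)
    {F G : C(SSet.toTop.obj (nerve P), SSet.toTop.obj (nerve P))}
    (hF : ∀ (n : ℕ) (x : Fin (n + 1) →o P) (t), F (chainPt x t) = chainPt (f.comp x) t)
    (hG : ∀ (n : ℕ) (x : Fin (n + 1) →o P) (t), G (chainPt x t) = chainPt (g.comp x) t) :
    F.Homotopic G := by
  choose h hh using fun (n : ℕ) (x : Fin (n + 1) →o P) => exists_prism hfg x
  obtain ⟨H, hH⟩ := exists_continuousMap_toTop (X := nerve P)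
    (fun n x => (h n ⟨nerveVertex (m := ⦋n⦌) x, nerveVertex_mono x⟩).curry)
    (fun n m x θ t => by
      refine ContinuousMap.ext fun r => ?_
      let y : Fin (n + 1) →o P := ⟨nerveVertex (m := ⦋n⦌) x, nerveVertex_mono x⟩
      change h m (y.comp θ.toOrderHom) (t, r) = h n y (stdSimplex.map θ.toOrderHom t, r)
      obtain ⟨k, hk, hk'⟩ := exists_threshold t r
      have h₁ := chainWeight_prismChain hfg (y.comp θ.toOrderHom) t r hk hk'
      rw [hh _ _ _ _ _ _ _ h₁, hh _ _ _ _ _ _ _ (h₁.trans _)]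
      have hl : lowerPart (stdSimplex.map θ.toOrderHom t) r =
          fun i => ∑ j with θ.toOrderHom j = i, lowerPart t r j :=
        funext fun i => lowerPart_map r θ.toOrderHom t i
      have hu : upperPart (stdSimplex.map θ.toOrderHom t) r =
          fun i => ∑ j with θ.toOrderHom j = i, upperPart t r j := by
        funext i
        simp only [upperPart, hl, stdSimplex_map_apply, Finset.sum_sub_distrib]
      rw [hl, hu, chainWeight_sum_fiber, chainWeight_sum_fiber]
      rfl)
  have hH' (n : ℕ) (x : Fin (n + 1) →o P) (t) (r : I) : H (chainPt x t) r = h n x (t, r) :=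
    congrArg (fun c : C(I, SSet.toTop.obj (nerve P)) => c r) (hH n x.monotone.functor t)
  have hcont : Continuous fun z : I × SSet.toTop.obj (nerve P) => H z.2 z.1 :=
    (ContinuousMap.continuous_uncurry_of_continuous H).comp continuous_swap
  -- At time `0` all mass is above the threshold and is moved by `g`; hence the homotopy runs from
  -- `G` to `F`.
  refine ContinuousMap.Homotopic.symm ⟨⟨⟨fun z => H z.2 z.1, hcont⟩, fun z => ?_, fun z => ?_⟩⟩
  · have : (⟨fun z => H z 0, hcont.comp (.prodMk_right 0)⟩ : C(_, _)) = G := by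
      refine toTop_nerve_hom_ext fun n x t => ?_
      rw [hG]
      refine (hH' n x t 0).trans (hh _ _ _ _ _ _ _ ?_)
      have hl : lowerPart t (0 : I) = 0 := lowerPart_zero t
      have hu : upperPart t (0 : I) = t := funext fun i => by
        rw [upperPart, hl, Pi.zero_apply, sub_zero]
      rw [hl, hu]
      funext p
      simp [chainWeight]
      rfl
    exact congrArg (fun c : C(_, _) => c z) this
  · have : (⟨fun z => H z 1, hcont.comp (.prodMk_right 1)⟩ : C(_, _)) = F := by
      refine toTop_nerve_hom_ext fun n x t => ?_
      rw [hF]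
      refine (hH' n x t 1).trans (hh _ _ _ _ _ _ _ ?_)
      have hl : lowerPart t (1 : I) = t := lowerPart_one t
      have hu : upperPart t (1 : I) = 0 := funext fun i => by
        rw [upperPart, hl, Pi.zero_apply, sub_self]
      rw [hl, hu]
      funext p
      simp [chainWeight]
      rfl
    exact congrArg (fun c : C(_, _) => c z) this

theorem contractibleSpace_classifyingSpace (hc : ∃ c : P, ∀ x : P, ∃ m, IsGLB {c, x} m) :
    ContractibleSpace (classifyingSpace P) := by
  obtain ⟨c, hc⟩ := hc
  simp only [isGLB_pair_iff] at hc
  choose μ hμ using hc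
  let f : P →o P := ⟨μ, fun x y hxy =>
    (hμ y).2.2 _ (hμ x).1 ((hμ x).2.1.trans hxy)⟩
  obtain ⟨F, hF⟩ := exists_toTop_map f
  let K : C(SSet.toTop.obj (nerve P), SSet.toTop.obj (nerve P)) :=
    ContinuousMap.const _ (chainPt (OrderHom.const (Fin (0 + 1)) c) default)
  have h₁ : F.Homotopic (ContinuousMap.id _) :=
    homotopic_of_le (g := OrderHom.id) (fun x => (hμ x).2.1) hF fun _ _ _ => rfl
  have h₂ : F.Homotopic K := by
    -- The constant chain `c` has all its mass at `c`, so it represents the same point as the vertex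
    -- `c`.
    refine homotopic_of_le (g := OrderHom.const P c) (fun x => (hμ x).1) hF fun n x t => ?_
    refine chainPt_eq_of_chainWeight_eq (funext fun p => ?_)
    have hs := stdSimplex.sum_eq_one t
    by_cases hp : c = p
    · simp [chainWeight, hp, hs]
    · simp [chainWeight, hp]
  exact (contractible_iff_id_nullhomotopic _).2 ⟨_, h₁.symm.trans h₂⟩

end Homotopy

theorem mainTheorem5 {P : Type u} [PartialOrder P]
    (hc : ∃ c : P, ∀ x : P, (∃ m, IsGLB {c, x} m) ∧ (∃ j, IsLUB {c, x} j))
    (hmeet : ∀ a b : P, (∃ x, x ≤ a ∧ x ≤ b) → ∃ m, IsGLB {a, b} m)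
    (hjoin : ∀ a b : P, (∃ x, a ≤ x ∧ b ≤ x) → ∃ j, IsLUB {a, b} j) :
    IsComponentOfWeakEquivalences P ∧
      IsFibrant (PartOrd.of P) ∧
      ContractibleSpace (classifyingSpace P) := by
  obtain ⟨c, hc'⟩ := hc
  exact ⟨isComponentOfWeakEquivalences ⟨c, hc'⟩ hmeet hjoin,
    isFibrant_of_exists_isLUB ⟨c, fun x => (hc' x).2⟩,
    contractibleSpace_classifyingSpace ⟨c, fun x => (hc' x).1⟩⟩
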